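/- Let $\mathfrak g$ be a finite-dimensional complex simple Lie algebra with Cartan subalgebra $\mathfrak h$, root system $\Delta\subset\mathfrak h^*$ and Killing form $\langle\cdot,\cdot\rangle$ (also used for the induced form on $\mathfrak h^*\cong\mathfrak h$). Choose root vectors $E_\alpha\in\mathfrak g_\alpha$ ($\alpha\in\Delta$) with $\langle E_\alpha,E_{-\alpha}\rangle=1$, and let $\Omega\in\mathfrak g\otimes\mathfrak g$ be the Casimir element of the Killing form. Regard $\wedge^\bullet\mathfrak g$ as the skew-symmetric tensors, with $x\wedge y=x\otimes y-y\otimes x$ and $x\wedge y\wedge z$ the signed sum over the six permutations. Let $U\subset\mathfrak h^*$ be a connected open set. A meromorphic function $r:U\to\wedge^2\mathfrak g$ is called a dynamical $r$-matrix (with coupling constant $2$) if $[h,r(\lambda)]=0$ for all $h\in\mathfrak h$ and $$\mathrm{Alt}(dr)+\tfrac12[r,r]=[\Omega^{12},\Omega^{23}],\qquad \mathrm{Alt}(dr)=\sum_i h_i\wedge\frac{\partial r}{\partial\lambda_i},$$ where $[\cdot,\cdot]$ on the left is the Schouten bracket, $(h_i)$ is a basis of $\mathfrak h$ and $\lambda_i=\lambda(h_i)$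 are the corresponding coordinates on $\mathfrak h^*$; the equations are identities of meromorphic functions. A meromorphic function $r:U\to\wedge^2\mathfrak g$ is a dynamical $r$-matrix if and only if there are a choice of simple roots of $\Delta$, with positive roots $\Delta_+$, a subset $S$ of these simple roots, an element $\lambda_0\in\mathfrak h\cong\mathfrak h^*$ and a closed meromorphic 2-form $\omega$ on $U$ such that, as meromorphic functions on $U$, $$r(\lambda)=\omega(\lambda)+\sum_{\alpha\in[S]}\coth\langle\alpha,\lambda+\lambda_0\rangle\,E_\alpha\wedge E_{-\alpha}+\sum_{\alpha\in\Delta_+\setminus[S]}E_\alpha\wedge E_{-\alpha}.$$ Here $[S]\subset\Delta_+$ is the set of positive roots that are combinations of elements of $S$ with non-negative integer coefficients, and a 2-form on $U$ is regarded as a function $U\to\wedge^2\mathfrak h\subset\wedge^2\mathfrak g$ by identifying $d\lambda_i$ with $h_i$. -/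

import Mathlib

open Module TensorProduct Filter Topology

noncomputable section

namespace DynamicalRMatrix

/-! ### Complex analysis on finite-dimensional spaces

Finite-dimensional complex vector spaces carry exactly one Hausdorff vector space topology, and all
norms on them are equivalent.  The spaces `𝔥*` and `𝔤 ⊗ 𝔤` have no norm in Mathlib; we give them the
sup norm of the coordinates in some basis.  Openness, analyticity and derivatives do not depend on
this choice. -/

/-- The norm on a finite-dimensional complex vector space given by the coordinates in a basis. -/
abbrev coordNorm (V : Type*) [AddCommGroup V] [Module ℂ V] [FiniteDimensional ℂ V] :
    NormedAddCommGroup V :=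
  NormedAddCommGroup.induced V (Fin (finrank ℂ V) → ℂ)
    ((finBasis ℂ V).equivFun : V →ₗ[ℂ] (Fin (finrank ℂ V) → ℂ)) (finBasis ℂ V).equivFun.injective

/-- The normed space structure belonging to `coordNorm`. -/
abbrev coordNormedSpace (V : Type*) [AddCommGroup V] [Module ℂ V] [FiniteDimensional ℂ V] :
    letI := coordNorm V
    NormedSpace ℂ V :=
  letI := coordNorm V
  NormedSpace.induced ℂ V (Fin (finrank ℂ V) → ℂ)
    ((finBasis ℂ V).equivFun : V →ₗ[ℂ] (Fin (finrank ℂ V) → ℂ))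

instance dualNormedAddCommGroup (V : Type*) [AddCommGroup V] [Module ℂ V]
    [FiniteDimensional ℂ V] : NormedAddCommGroup (Dual ℂ V) :=
  coordNorm (Dual ℂ V)

instance dualNormedSpace (V : Type*) [AddCommGroup V] [Module ℂ V]
    [FiniteDimensional ℂ V] : NormedSpace ℂ (Dual ℂ V) :=
  coordNormedSpace (Dual ℂ V)

instance tensorNormedAddCommGroup (𝔤 : Type*) [LieRing 𝔤] [LieAlgebra ℂ 𝔤]
    [FiniteDimensional ℂ 𝔤] : NormedAddCommGroup (𝔤 ⊗[ℂ] 𝔤) :=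
  coordNorm (𝔤 ⊗[ℂ] 𝔤)

instance tensorNormedSpace (𝔤 : Type*) [LieRing 𝔤] [LieAlgebra ℂ 𝔤]
    [FiniteDimensional ℂ 𝔤] : NormedSpace ℂ (𝔤 ⊗[ℂ] 𝔤) :=
  coordNormedSpace (𝔤 ⊗[ℂ] 𝔤)

section Meromorphic

variable {E F : Type*} [NormedAddCommGroup E] [NormedSpace ℂ E]
  [NormedAddCommGroup F] [NormedSpace ℂ F]

/-- `P` holds at the generic point of `U`: near every point of `U` it holds off the zero set of
a holomorphic function that does not vanish identically near that point.  Two meromorphic functions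
are equal as meromorphic functions when their values agree generically; the values that a total
function takes at poles are irrelevant. -/
def GenericallyOn (U : Set E) (P : E → Prop) : Prop :=
  ∀ x ∈ U, ∃ q : E → ℂ, AnalyticAt ℂ q x ∧ (¬ ∀ᶠ y in 𝓝 x, q y = 0) ∧
    ∀ᶠ y in 𝓝 x, q y ≠ 0 → P y

/-- `f` is meromorphic on the open set `U` (several complex variables): near every point of `U` it
is a quotient `p / q` of holomorphic functions, `p` vector-valued and `q` scalar-valued and not
identically zero. -/
def IsMeromorphicOn (f : E → F) (U : Set E) : Prop :=
  ∀ x ∈ U, ∃ (q : E → ℂ) (p : E → F), AnalyticAt ℂ q x ∧ AnalyticAt ℂ p x ∧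
    (¬ ∀ᶠ y in 𝓝 x, q y = 0) ∧ ∀ᶠ y in 𝓝 x, q y ≠ 0 → f y = (q y)⁻¹ • p y

end Meromorphic

/-- The hyperbolic cotangent. -/
def coth (z : ℂ) : ℂ := Complex.cosh z / Complex.sinh z

/-! ### Tensors

`⋀²𝔤` and `⋀³𝔤` are realised as the skew-symmetric tensors in `𝔤 ⊗ 𝔤` and `𝔤 ⊗ (𝔤 ⊗ 𝔤)`, with
`x ∧ y = x ⊗ y - y ⊗ x` and `x ∧ y ∧ z` the sum of the six permutations with signs. -/

section Tensors

variable {𝔤 : Type*} [LieRing 𝔤] [LieAlgebra ℂ 𝔤]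

/-- `x ∧ y = x ⊗ y - y ⊗ x`. -/
def wedge (x y : 𝔤) : 𝔤 ⊗[ℂ] 𝔤 := x ⊗ₜ y - y ⊗ₜ x

/-- `x ∧ y ∧ z` as a skew-symmetric tensor. -/
def wedge₃ (x y z : 𝔤) : 𝔤 ⊗[ℂ] (𝔤 ⊗[ℂ] 𝔤) :=
  x ⊗ₜ (y ⊗ₜ z) - x ⊗ₜ (z ⊗ₜ y) + y ⊗ₜ (z ⊗ₜ x) - y ⊗ₜ (x ⊗ₜ z) + z ⊗ₜ (x ⊗ₜ y) - z ⊗ₜ (y ⊗ₜ x)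

variable (𝔤)

/-- `⋀²𝔤`, the skew-symmetric tensors: those with `t²¹ = -t`. -/
def wedgeTwo : Submodule ℂ (𝔤 ⊗[ℂ] 𝔤) :=
  LinearMap.ker ((TensorProduct.comm ℂ 𝔤 𝔤 : 𝔤 ⊗[ℂ] 𝔤 →ₗ[ℂ] 𝔤 ⊗[ℂ] 𝔤) + LinearMap.id)

/-- `x ⊗ t ↦ x ∧ t` for `t ∈ ⋀²𝔤`, i.e. `x¹ t²³ - x² t¹³ + x³ t¹²`. -/
def wedgeLeft : 𝔤 ⊗[ℂ] (𝔤 ⊗[ℂ] 𝔤) →ₗ[ℂ] 𝔤 ⊗[ℂ] (𝔤 ⊗[ℂ] 𝔤) :=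
  LinearMap.id
    - (TensorProduct.leftComm ℂ 𝔤 𝔤 𝔤 : 𝔤 ⊗[ℂ] (𝔤 ⊗[ℂ] 𝔤) →ₗ[ℂ] 𝔤 ⊗[ℂ] (𝔤 ⊗[ℂ] 𝔤))
    + (TensorProduct.assoc ℂ 𝔤 𝔤 𝔤 : (𝔤 ⊗[ℂ] 𝔤) ⊗[ℂ] 𝔤 →ₗ[ℂ] 𝔤 ⊗[ℂ] (𝔤 ⊗[ℂ] 𝔤)) ∘ₗ
      (TensorProduct.comm ℂ 𝔤 (𝔤 ⊗[ℂ] 𝔤) : 𝔤 ⊗[ℂ] (𝔤 ⊗[ℂ] 𝔤) →ₗ[ℂ] (𝔤 ⊗[ℂ] 𝔤) ⊗[ℂ] 𝔤)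

/-- The Lie bracket as a linear map `x ⊗ y ↦ ⁅x, y⁆`. -/
def bracketMap : 𝔤 ⊗[ℂ] 𝔤 →ₗ[ℂ] 𝔤 :=
  TensorProduct.lift (LieAlgebra.ad ℂ 𝔤 : 𝔤 →ₗ[ℂ] Module.End ℂ 𝔤)

/-- The bilinear map with `(a ⊗ b, c ⊗ d) ↦ ⁅a, c⁆ ∧ b ∧ d`.  On `⋀²𝔤 × ⋀²𝔤` it is the Schouten
bracket, see `schouten_wedge`. -/
def schouten : 𝔤 ⊗[ℂ] 𝔤 →ₗ[ℂ] 𝔤 ⊗[ℂ] 𝔤 →ₗ[ℂ] 𝔤 ⊗[ℂ] (𝔤 ⊗[ℂ] 𝔤) :=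
  TensorProduct.curry
    (wedgeLeft 𝔤 ∘ₗ
      TensorProduct.map (bracketMap 𝔤)
        (LinearMap.id - (TensorProduct.comm ℂ 𝔤 𝔤 : 𝔤 ⊗[ℂ] 𝔤 →ₗ[ℂ] 𝔤 ⊗[ℂ] 𝔤)) ∘ₗ
      (TensorProduct.tensorTensorTensorComm ℂ 𝔤 𝔤 𝔤 𝔤 :
        (𝔤 ⊗[ℂ] 𝔤) ⊗[ℂ] (𝔤 ⊗[ℂ] 𝔤) →ₗ[ℂ] (𝔤 ⊗[ℂ] 𝔤) ⊗[ℂ] (𝔤 ⊗[ℂ] 𝔤)))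

/-- The bilinear map `(s, t) ↦ [s¹², t²³]`, that is `(a ⊗ b, c ⊗ d) ↦ a ⊗ ⁅b, c⁆ ⊗ d`. -/
def comm₁₂₂₃ : 𝔤 ⊗[ℂ] 𝔤 →ₗ[ℂ] 𝔤 ⊗[ℂ] 𝔤 →ₗ[ℂ] 𝔤 ⊗[ℂ] (𝔤 ⊗[ℂ] 𝔤) :=
  TensorProduct.curry
    ((LinearMap.lTensor 𝔤 ((LinearMap.rTensor 𝔤 (bracketMap 𝔤)) ∘ₗ
        ((TensorProduct.assoc ℂ 𝔤 𝔤 𝔤).symm :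
          𝔤 ⊗[ℂ] (𝔤 ⊗[ℂ] 𝔤) →ₗ[ℂ] (𝔤 ⊗[ℂ] 𝔤) ⊗[ℂ] 𝔤))) ∘ₗ
      (TensorProduct.assoc ℂ 𝔤 𝔤 (𝔤 ⊗[ℂ] 𝔤) :
        (𝔤 ⊗[ℂ] 𝔤) ⊗[ℂ] (𝔤 ⊗[ℂ] 𝔤) →ₗ[ℂ] 𝔤 ⊗[ℂ] (𝔤 ⊗[ℂ] (𝔤 ⊗[ℂ] 𝔤))))

variable {𝔤}

theorem mem_wedgeTwo {t : 𝔤 ⊗[ℂ] 𝔤} : t ∈ wedgeTwo 𝔤 ↔ TensorProduct.comm ℂ 𝔤 𝔤 t = -t := by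
  simp [wedgeTwo, eq_neg_iff_add_eq_zero]

theorem wedgeLeft_tmul (x y z : 𝔤) : wedgeLeft 𝔤 (x ⊗ₜ (y ⊗ₜ z)) =
    x ⊗ₜ (y ⊗ₜ z) - y ⊗ₜ (x ⊗ₜ z) + y ⊗ₜ (z ⊗ₜ x) := by
  simp [wedgeLeft]

theorem wedgeLeft_tmul_wedge (x y z : 𝔤) : wedgeLeft 𝔤 (x ⊗ₜ wedge y z) = wedge₃ x y z := by
  simp only [wedge, wedge₃, tmul_sub, map_sub, wedgeLeft_tmul]
  abel

theorem schouten_tmul (a b c d : 𝔤) :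
    schouten 𝔤 (a ⊗ₜ b) (c ⊗ₜ d) = wedge₃ ⁅a, c⁆ b d := by
  rw [← wedgeLeft_tmul_wedge]
  simp [schouten, bracketMap, wedge]

/-- The defining formula of the Schouten bracket on decomposable bivectors. -/
theorem schouten_wedge (a b c d : 𝔤) :
    schouten 𝔤 (wedge a b) (wedge c d) =
      wedge₃ ⁅a, c⁆ b d - wedge₃ ⁅a, d⁆ b c - wedge₃ ⁅b, c⁆ a d + wedge₃ ⁅b, d⁆ a c := by
  simp only [wedge, map_sub, LinearMap.sub_apply, schouten_tmul]
  abel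

theorem comm₁₂₂₃_tmul (a b c d : 𝔤) :
    comm₁₂₂₃ 𝔤 (a ⊗ₜ b) (c ⊗ₜ d) = a ⊗ₜ (⁅b, c⁆ ⊗ₜ d) := by
  simp [comm₁₂₂₃, bracketMap]

end Tensors

/-! ### Dynamical r-matrices -/

section Lie

variable {𝔤 : Type*} [LieRing 𝔤] [LieAlgebra ℂ 𝔤] [FiniteDimensional ℂ 𝔤]

variable (𝔤) in
/-- The Casimir element `Ω = ∑ᵢ eᵢ ⊗ eⁱ` of the Killing form, with `(eᵢ)` a basis of `𝔤` and `(eⁱ)`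
the dual basis for the Killing form. -/
def casimir [LieAlgebra.IsKilling ℂ 𝔤] : 𝔤 ⊗[ℂ] 𝔤 :=
  ∑ i, finBasis ℂ 𝔤 i ⊗ₜ[ℂ]
    LinearMap.BilinForm.dualBasis (killingForm ℂ 𝔤)
      (LieAlgebra.IsKilling.killingForm_nondegenerate ℂ 𝔤) (finBasis ℂ 𝔤) i

variable {H : LieSubalgebra ℂ 𝔤}

/-- `Alt(dr) = ∑ᵢ hᵢ ∧ ∂r/∂λᵢ`, with `(hᵢ)` a basis of `𝔥` and `λᵢ` the corresponding linear
coordinates on `𝔥*`, so that `∂/∂λᵢ` is the derivative along the dual basis vector `hᵢ*`. -/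
def altD (r : Dual ℂ H → 𝔤 ⊗[ℂ] 𝔤) (lam : Dual ℂ H) : 𝔤 ⊗[ℂ] (𝔤 ⊗[ℂ] 𝔤) :=
  ∑ i, wedgeLeft 𝔤 ((finBasis ℂ H i : 𝔤) ⊗ₜ[ℂ] fderiv ℂ r lam ((finBasis ℂ H).coord i))

/-- `r` is a dynamical r-matrix on `U ⊆ 𝔥*` with coupling constant `ε`: a meromorphic function
`U → ⋀²𝔤` of zero weight with `Alt(dr) + ½[r, r] = (ε²/4) [Ω¹², Ω²³]`.  The two equations are
identities between meromorphic functions. -/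
structure IsDynamicalRMatrix [LieAlgebra.IsKilling ℂ 𝔤] (ε : ℂ) (U : Set (Dual ℂ H))
    (r : Dual ℂ H → 𝔤 ⊗[ℂ] 𝔤) : Prop where
  mem_wedgeTwo : ∀ lam ∈ U, r lam ∈ wedgeTwo 𝔤
  meromorphic : IsMeromorphicOn r U
  zeroWeight : GenericallyOn U fun lam => ∀ h : H, ⁅(h : 𝔤), r lam⁆ = 0
  cdybe : GenericallyOn U fun lam =>
    altD r lam + (1 / 2 : ℂ) • schouten 𝔤 (r lam) (r lam) =
      (ε ^ 2 / 4) • comm₁₂₂₃ 𝔤 (casimir 𝔤) (casimir 𝔤)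

/-- The element `∑_{i,j} ω(hᵢ*, hⱼ*) hᵢ ⊗ hⱼ = ∑_{i<j} ω(hᵢ*, hⱼ*) hᵢ ∧ hⱼ` of `⋀²𝔥 ⊆ ⋀²𝔤`
corresponding to the 2-form `ω` on the vector space `𝔥*`; it identifies `dλᵢ` with `hᵢ`. -/
def formToTensor (w : Dual ℂ H [⋀^Fin 2]→L[ℂ] ℂ) : 𝔤 ⊗[ℂ] 𝔤 :=
  ∑ i, ∑ j, w ![(finBasis ℂ H).coord i, (finBasis ℂ H).coord j] •
    ((finBasis ℂ H i : 𝔤) ⊗ₜ[ℂ] (finBasis ℂ H j : 𝔤))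

/-- `w` is a closed meromorphic 2-form on `U ⊆ 𝔥*`. -/
structure IsClosedMeromorphicTwoForm (w : Dual ℂ H → Dual ℂ H [⋀^Fin 2]→L[ℂ] ℂ)
    (U : Set (Dual ℂ H)) : Prop where
  meromorphic : IsMeromorphicOn w U
  closed : GenericallyOn U fun lam => extDeriv w lam = 0

end Lie

section Roots

open LieAlgebra.IsKilling

variable {𝔤 : Type*} [LieRing 𝔤] [LieAlgebra ℂ 𝔤] [FiniteDimensional ℂ 𝔤]
  [LieAlgebra.IsKilling ℂ 𝔤] {H : LieSubalgebra ℂ 𝔤} [H.IsCartanSubalgebra]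

/-- The bilinear form on `𝔥*` induced by the Killing form, through the identification
`cartanEquivDual H : 𝔥 ≃ 𝔥*` given by the Killing form. -/
def dualPairing (a b : Dual ℂ H) : ℂ :=
  killingForm ℂ 𝔤 ((cartanEquivDual H).symm a) ((cartanEquivDual H).symm b)

/-- The positive roots of a base of simple roots. -/
def positiveRoots (b : (rootSystem H).Base) : Set H.root := {a | b.IsPos a}

/-- `[S]`: the positive roots which are combinations, with coefficients in `ℕ`, of the simple
roots in `S`. -/
def spannedRoots (b : (rootSystem H).Base) (S : Set H.root) : Set H.root :=
  {a ∈ positiveRoots b | (rootSystem H).root a ∈ AddSubmonoid.closure ((rootSystem H).root '' S)}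

open Classical in
/-- `∑_{α ∈ [S]} coth⟨α, λ + λ₀⟩ E_α ∧ E_{-α} + ∑_{α ∈ Δ₊ \ [S]} E_α ∧ E_{-α}`, with `λ₀ ∈ 𝔥`
regarded as an element of `𝔥*` through the Killing form. -/
def standardRMatrix (E : LieModule.Weight ℂ H 𝔤 → 𝔤) (b : (rootSystem H).Base)
    (S : Set H.root) (lam₀ : H) (lam : Dual ℂ H) : 𝔤 ⊗[ℂ] 𝔤 :=
  (∑ a : H.root with a ∈ spannedRoots b S,
      coth (dualPairing ((rootSystem H).root a) (lam + cartanEquivDual H lam₀)) •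
        wedge (E a) (E (-a))) +
    ∑ a : H.root with a ∈ positiveRoots b \ spannedRoots b S, wedge (E a) (E (-a))

end Roots

end DynamicalRMatrix

end

/-! A skew tensor of weight zero is determined by its component in `𝔥 ⊗ 𝔥`, which is a 2-form, and
by the coefficients `φ_α` of `E_α ⊗ E_{-α}`, which are odd in `α`. Pairing the dynamical Yang-Baxter
equation through the Killing form with triples taken from `𝔥` and the root vectors splits it into
three families (`cdybe_iff`, `cdybe_at_iff`). Triples in `𝔥` say that the 2-form is closed. Triples
`(h, E_α, E_{-α})` say `dφ_α = (1 - φ_α²)⟨α, ·⟩`. Triples of root vectors with `α + β + γ = 0` say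
`φ_α φ_β + φ_β φ_γ + φ_γ φ_α = -1`, because `⟨E_α, [E_β, E_γ]⟩ ≠ 0`. All other triples give no
condition.

For the direct implication, take a ball around a generic point `x₀`. There the Riccati equation
leaves `φ_α = ±1` or `φ_α = coth(⟨α, ·⟩ + c)`. By the algebraic relation the roots with `φ_α(x₀) ≠
-1` form a parabolic set, so they contain the positive roots of some base
(`exists_base_forall_isPos_mem`). The simple roots whose negatives also lie in this set form `S`; by
`root_mem_closure_of_neg_mem`, positive roots outside `[S]` have `φ_α = 1`. Simple roots are
linearly independent, so one `λ₀` realises the constants `c` of all roots in `S`, and the addition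
law of `coth` carries the formula to `[S]` (`exists_eq_stdCoeff`). The identity theorem for
meromorphic functions spreads the local formula over the connected set `U`.

For the converse, the three families are verified at generic points. The algebraic one reduces to
the addition law of `coth` on `[S]`, and outside `[S]` to the fact that `φ_{α+β}` and one of `φ_α`,
`φ_β` equal `1`. -/

set_option linter.unusedSectionVars false

noncomputable section

namespace DynamicalRMatrix

/-! ### Generic identities and meromorphic functions of several variables. -/

section Meromorphic

variable {E F G : Type*} [NormedAddCommGroup E] [NormedSpace ℂ E]
  [NormedAddCommGroup F] [NormedSpace ℂ F] [NormedAddCommGroup G] [NormedSpace ℂ G]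

/-- Near a point of analyticity, a function vanishes identically as soon as its germ at one point
does. -/
theorem exists_isOpen_forall_eq_zero [CompleteSpace F] {p : E → F} {x : E}
    (hp : AnalyticAt ℂ p x) :
    ∃ V, IsOpen V ∧ x ∈ V ∧ AnalyticOnNhd ℂ p V ∧
      ∀ y ∈ V, (∀ᶠ z in 𝓝 y, p z = 0) → ∀ z ∈ V, p z = 0 := by
  obtain ⟨ε, hε, h⟩ := Metric.eventually_nhds_iff_ball.mp hp.eventually_analyticAt
  exact ⟨Metric.ball x ε, Metric.isOpen_ball, Metric.mem_ball_self hε, h, fun y hy h0 z hz =>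
    AnalyticOnNhd.eqOn_zero_of_preconnected_of_eventuallyEq_zero h
      (convex_ball x ε).isPreconnected hy h0 hz⟩

theorem eventually_not_eventually_eq_zero {q : E → ℂ} {x : E} (hq : AnalyticAt ℂ q x)
    (h : ¬ ∀ᶠ y in 𝓝 x, q y = 0) : ∀ᶠ y in 𝓝 x, ¬ ∀ᶠ z in 𝓝 y, q z = 0 := by
  obtain ⟨V, hV, hx, -, hz⟩ := exists_isOpen_forall_eq_zero hq
  filter_upwards [hV.mem_nhds hx] with y hy hy0
  exact h (eventually_of_mem (hV.mem_nhds hx) (hz y hy hy0))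

/-- Germs of analytic functions form a domain: at a nearby point with `q ≠ 0`, a vanishing product
would kill the germ of `q'`. This is what allows generic conditions and denominators to be combined.
-/
theorem not_eventually_mul_eq_zero {q q' : E → ℂ} {x : E} (hq : AnalyticAt ℂ q x)
    (hq' : AnalyticAt ℂ q' x) (h : ¬ ∀ᶠ y in 𝓝 x, q y = 0) (h' : ¬ ∀ᶠ y in 𝓝 x, q' y = 0) :
    ¬ ∀ᶠ y in 𝓝 x, q y * q' y = 0 := by
  intro h0
  have hev := h0.eventually_nhds.and
    ((eventually_not_eventually_eq_zero hq' h').and hq.eventually_analyticAt)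
  obtain ⟨y, hy, hy0, hy', hya⟩ := ((not_eventually.mp h).and_eventually hev).exists
  refine hy' ?_
  filter_upwards [hy0, hya.continuousAt.eventually_ne hy] with z hz hz'
  exact (mul_eq_zero.mp hz).resolve_left hz'

theorem GenericallyOn.mono {U : Set E} {P Q : E → Prop} (h : GenericallyOn U P)
    (hPQ : ∀ x ∈ U, P x → Q x) (hU : IsOpen U) : GenericallyOn U Q := by
  intro x hx
  obtain ⟨q, hq, hq0, hP⟩ := h x hx
  refine ⟨q, hq, hq0, ?_⟩
  filter_upwards [hP, hU.mem_nhds hx] with y hy hyU hy0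
  exact hPQ y hyU (hy hy0)

theorem GenericallyOn.and {U : Set E} {P Q : E → Prop} (h : GenericallyOn U P)
    (h' : GenericallyOn U Q) : GenericallyOn U fun x => P x ∧ Q x := by
  intro x hx
  obtain ⟨q, hq, hq0, hP⟩ := h x hx
  obtain ⟨q', hq', hq0', hQ⟩ := h' x hx
  refine ⟨fun y => q y * q' y, hq.mul hq', not_eventually_mul_eq_zero hq hq' hq0 hq0', ?_⟩
  filter_upwards [hP, hQ] with y hy hy' h0
  exact ⟨hy (left_ne_zero_of_mul h0), hy' (right_ne_zero_of_mul h0)⟩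

theorem genericallyOn_of_forall {U : Set E} {P : E → Prop} (hU : IsOpen U)
    (h : ∀ x ∈ U, P x) : GenericallyOn U P := fun x hx =>
  ⟨fun _ => 1, analyticAt_const, by simp [nhds_neBot.ne],
    eventually_of_mem (hU.mem_nhds hx) fun y hy _ => h y hy⟩

theorem GenericallyOn.forall_finset {ι : Type*} {U : Set E} (hU : IsOpen U) {P : ι → E → Prop}
    (s : Finset ι) (h : ∀ i ∈ s, GenericallyOn U (P i)) :
    GenericallyOn U fun x => ∀ i ∈ s, P i x := by
  classical
  induction s using Finset.induction_on with
  | empty => exact genericallyOn_of_forall hU (by simp)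
  | insert a s ha ih =>
    simp only [Finset.forall_mem_insert] at h ⊢
    exact h.1.and (ih h.2)

/-- The locus `q ≠ 0` is open. A generic identity therefore holds near a generic point and may be
differentiated there. -/
theorem GenericallyOn.eventually {U : Set E} {P : E → Prop} (h : GenericallyOn U P) :
    GenericallyOn U fun x => ∀ᶠ y in 𝓝 x, P y := by
  intro x hx
  obtain ⟨q, hq, hq0, hP⟩ := h x hx
  refine ⟨q, hq, hq0, ?_⟩
  filter_upwards [hP.eventually_nhds, hq.eventually_analyticAt] with y hy hya hy0
  filter_upwards [hy, hya.continuousAt.eventually_ne hy0] with z hz hz0 using hz hz0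

theorem GenericallyOn.exists_mem {U : Set E} {P : E → Prop} (hU : IsOpen U)
    (h : GenericallyOn U P) (hne : U.Nonempty) : ∃ x ∈ U, P x := by
  obtain ⟨x, hx⟩ := hne
  obtain ⟨q, hq, hq0, hP⟩ := h x hx
  obtain ⟨y, hy, hyP, hyU⟩ := ((not_eventually.mp hq0).and_eventually
    (hP.and (hU.mem_nhds hx))).exists
  exact ⟨y, hyU, hyP hy⟩

theorem genericallyOn_ne_zero {U : Set E} {q : E → ℂ} (hq : ∀ x ∈ U, AnalyticAt ℂ q x)
    (h : ∀ x ∈ U, ¬ ∀ᶠ y in 𝓝 x, q y = 0) : GenericallyOn U fun x => q x ≠ 0 := fun x hx =>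
  ⟨q, hq x hx, h x hx, Eventually.of_forall fun _ hy => hy⟩

theorem IsMeromorphicOn.genericallyOn_analyticAt [CompleteSpace F] {U : Set E} {f : E → F}
    (hf : IsMeromorphicOn f U) : GenericallyOn U fun x => AnalyticAt ℂ f x := by
  intro x hx
  obtain ⟨q, p, hq, hp, hq0, h⟩ := hf x hx
  refine ⟨q, hq, hq0, ?_⟩
  filter_upwards [hq.eventually_analyticAt, hp.eventually_analyticAt, h.eventually_nhds]
    with y hqy hpy hy hy0
  refine ((hqy.inv hy0).smul hpy).congr ?_
  filter_upwards [hy, hqy.continuousAt.eventually_ne hy0] with z hz hz0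
  simp [hz hz0]

theorem isMeromorphicOn_of_analyticOnNhd {U : Set E} {f : E → F} (hf : AnalyticOnNhd ℂ f U) :
    IsMeromorphicOn f U := fun x hx =>
  ⟨fun _ => 1, f, analyticAt_const, hf x hx, by simp [nhds_neBot.ne],
    Eventually.of_forall fun _ _ => by simp⟩

theorem IsMeromorphicOn.add {U : Set E} {f g : E → F} (hf : IsMeromorphicOn f U)
    (hg : IsMeromorphicOn g U) : IsMeromorphicOn (fun x => f x + g x) U := by
  intro x hx
  obtain ⟨q, p, hq, hp, hq0, h⟩ := hf x hx
  obtain ⟨q', p', hq', hp', hq0', h'⟩ := hg x hx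
  refine ⟨fun y => q y * q' y, fun y => q' y • p y + q y • p' y, hq.mul hq',
    (hq'.smul hp).add (hq.smul hp'), not_eventually_mul_eq_zero hq hq' hq0 hq0', ?_⟩
  filter_upwards [h, h'] with y hy hy' h0
  have h1 := left_ne_zero_of_mul h0
  have h2 := right_ne_zero_of_mul h0
  rw [hy h1, hy' h2, smul_add, smul_smul, smul_smul]
  congr 2 <;> field_simp

theorem IsMeromorphicOn.clm_comp {U : Set E} {f : E → F} (hf : IsMeromorphicOn f U)
    (L : F →L[ℂ] G) : IsMeromorphicOn (fun x => L (f x)) U := by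
  intro x hx
  obtain ⟨q, p, hq, hp, hq0, h⟩ := hf x hx
  refine ⟨q, fun y => L (p y), hq, (L.analyticAt _).comp hp, hq0, ?_⟩
  filter_upwards [h] with y hy h0
  rw [hy h0, map_smul]

theorem IsMeromorphicOn.sub {U : Set E} {f g : E → F} (hf : IsMeromorphicOn f U)
    (hg : IsMeromorphicOn g U) : IsMeromorphicOn (fun x => f x - g x) U := by
  simpa [sub_eq_add_neg] using hf.add (hg.clm_comp (-ContinuousLinearMap.id ℂ F))

theorem IsMeromorphicOn.sum {ι : Type*} {U : Set E} (s : Finset ι) {f : ι → E → F}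
    (hf : ∀ i ∈ s, IsMeromorphicOn (f i) U) : IsMeromorphicOn (fun x => ∑ i ∈ s, f i x) U := by
  classical
  induction s using Finset.induction_on with
  | empty => simpa using isMeromorphicOn_of_analyticOnNhd fun x _ => analyticAt_const
  | insert a s ha ih =>
    simp only [Finset.forall_mem_insert] at hf
    simpa only [Finset.sum_insert ha] using hf.1.add (ih hf.2)

/-- The identity theorem for meromorphic functions. -/
theorem IsMeromorphicOn.genericallyOn_eq_zero [CompleteSpace F] {U V : Set E} {f : E → F}
    (hf : IsMeromorphicOn f U) (hUc : IsPreconnected U) (hV : IsOpen V)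
    (hVU : V ⊆ U) (hVne : V.Nonempty) (h0 : ∀ x ∈ V, f x = 0) :
    GenericallyOn U fun x => f x = 0 := by
  -- `A` is the open set of points near which `f` vanishes generically. By connectedness it remains
  -- to see that `A` is closed in `U`.
  let A : Set E := {x | ∃ q : E → ℂ, AnalyticAt ℂ q x ∧ (¬ ∀ᶠ y in 𝓝 x, q y = 0) ∧
    ∀ᶠ y in 𝓝 x, q y ≠ 0 → f y = 0}
  have hA : IsOpen A := by
    rw [isOpen_iff_eventually]
    rintro x ⟨q, hq, hq0, hP⟩
    filter_upwards [hq.eventually_analyticAt, eventually_not_eventually_eq_zero hq hq0,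
      hP.eventually_nhds] with y h1 h2 h3 using ⟨q, h1, h2, h3⟩
  have hVA : V ⊆ A := fun x hx => genericallyOn_of_forall hV h0 x hx
  refine hUc.subset_of_closure_inter_subset hA ?_ ?_
  · obtain ⟨x, hx⟩ := hVne
    exact ⟨x, hVU hx, hVA hx⟩
  rintro x ⟨hxA, hxU⟩
  obtain ⟨q, p, hq, hp, hq0, h⟩ := hf x hxU
  obtain ⟨W, hW, hxW, -, hpW⟩ := exists_isOpen_forall_eq_zero hp
  have hev : ∀ᶠ y in 𝓝 x, AnalyticAt ℂ q y ∧ (¬ ∀ᶠ z in 𝓝 y, q z = 0) ∧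
      (∀ᶠ z in 𝓝 y, q z ≠ 0 → f z = (q z)⁻¹ • p z) ∧ y ∈ W := by
    filter_upwards [hq.eventually_analyticAt, eventually_not_eventually_eq_zero hq hq0,
      h.eventually_nhds, hW.mem_nhds hxW] with y h1 h2 h3 h4 using ⟨h1, h2, h3, h4⟩
  -- A point `y` of `A` close to the limit point `x` yields a point `z` where the germ of the
  -- numerator `p` is zero; hence `p` vanishes on all of `W`, a neighbourhood of `x`.
  obtain ⟨y, ⟨q', hq', hq0', hP'⟩, hqy, hq0y, hfy, hyW⟩ :=
    ((mem_closure_iff_frequently.mp hxA).and_eventually hev).exists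
  have hev' : ∀ᶠ z in 𝓝 y, q z * q' z ≠ 0 → ∀ᶠ w in 𝓝 z, p w = 0 := by
    filter_upwards [hfy.eventually_nhds, hP'.eventually_nhds, hqy.eventually_analyticAt,
      hq'.eventually_analyticAt] with z h1 h2 h3 h4 hz
    filter_upwards [h1, h2, h3.continuousAt.eventually_ne (left_ne_zero_of_mul hz),
      h4.continuousAt.eventually_ne (right_ne_zero_of_mul hz)] with w k1 k2 k3 k4
    have := (k1 k3).symm.trans (k2 k4)
    simpa [k3] using this
  obtain ⟨z, hz, hz', hzW⟩ := ((not_eventually.mp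
    (not_eventually_mul_eq_zero hqy hq' hq0y hq0')).and_eventually
      (hev'.and (hW.mem_nhds hyW))).exists
  have hp0 := hpW z hzW (hz' hz)
  refine ⟨q, hq, hq0, ?_⟩
  filter_upwards [h, hW.mem_nhds hxW] with w hw hwW hw0
  rw [hw hw0, hp0 w hwW, smul_zero]

end Meromorphic

/-! ### Components of tensors with respect to the Killing form. -/

section Pairing

variable {𝔤 : Type*} [LieRing 𝔤] [LieAlgebra ℂ 𝔤]

/-- The pairing `⟨x ⊗ y, t⟩` induced by the Killing form. -/
def killingPair (x y : 𝔤) : 𝔤 ⊗[ℂ] 𝔤 →ₗ[ℂ] ℂ :=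
  TensorProduct.dualDistrib ℂ 𝔤 𝔤 (killingForm ℂ 𝔤 x ⊗ₜ killingForm ℂ 𝔤 y)

/-- The pairing `⟨x ⊗ y ⊗ z, u⟩` induced by the Killing form. -/
def killingTriple (x y z : 𝔤) : 𝔤 ⊗[ℂ] (𝔤 ⊗[ℂ] 𝔤) →ₗ[ℂ] ℂ :=
  TensorProduct.dualDistrib ℂ 𝔤 (𝔤 ⊗[ℂ] 𝔤) (killingForm ℂ 𝔤 x ⊗ₜ killingPair y z)

/-- The contraction `a ⊗ b ↦ ⟨y, b⟩ a` of the second tensor factor with `y`. -/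
def contract (y : 𝔤) : 𝔤 ⊗[ℂ] 𝔤 →ₗ[ℂ] 𝔤 :=
  (TensorProduct.rid ℂ 𝔤 : 𝔤 ⊗[ℂ] ℂ →ₗ[ℂ] 𝔤) ∘ₗ LinearMap.lTensor 𝔤 (killingForm ℂ 𝔤 y)

@[simp] theorem killingPair_tmul (x y a b : 𝔤) :
    killingPair x y (a ⊗ₜ b) = killingForm ℂ 𝔤 x a * killingForm ℂ 𝔤 y b := by
  simp [killingPair]

@[simp] theorem killingTriple_tmul (x y z a : 𝔤) (t : 𝔤 ⊗[ℂ] 𝔤) :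
    killingTriple x y z (a ⊗ₜ t) = killingForm ℂ 𝔤 x a * killingPair y z t := by
  simp [killingTriple]

@[simp] theorem contract_tmul (y a b : 𝔤) :
    contract y (a ⊗ₜ b) = killingForm ℂ 𝔤 y b • a := by
  simp [contract]

theorem killingPair_add_left (x x' y : 𝔤) (t : 𝔤 ⊗[ℂ] 𝔤) :
    killingPair (x + x') y t = killingPair x y t + killingPair x' y t := by
  simp [killingPair, add_tmul]

theorem killingPair_add_right (x y y' : 𝔤) (t : 𝔤 ⊗[ℂ] 𝔤) :
    killingPair x (y + y') t = killingPair x y t + killingPair x y' t := by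
  simp [killingPair, tmul_add]

theorem killingPair_smul_left (c : ℂ) (x y : 𝔤) (t : 𝔤 ⊗[ℂ] 𝔤) :
    killingPair (c • x) y t = c * killingPair x y t := by
  rw [killingPair, map_smul, ← smul_tmul', map_smul]; rfl

theorem killingPair_smul_right (c : ℂ) (x y : 𝔤) (t : 𝔤 ⊗[ℂ] 𝔤) :
    killingPair x (c • y) t = c * killingPair x y t := by
  simp [killingPair]

theorem killingForm_contract (x y : 𝔤) (t : 𝔤 ⊗[ℂ] 𝔤) :
    killingForm ℂ 𝔤 x (contract y t) = killingPair x y t := by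
  induction t with
  | zero => simp
  | tmul a b => simp [mul_comm]
  | add s t hs ht => simp [hs, ht]

theorem killingForm_swap (x y : 𝔤) : killingForm ℂ 𝔤 x y = killingForm ℂ 𝔤 y x :=
  LieModule.traceForm_comm ℂ 𝔤 𝔤 x y

theorem killingForm_lie_left (x y z : 𝔤) :
    killingForm ℂ 𝔤 ⁅x, y⁆ z = killingForm ℂ 𝔤 x ⁅y, z⁆ :=
  LieModule.traceForm_apply_lie_apply ℂ 𝔤 𝔤 x y z

theorem killingForm_lie_cyclic (x y z : 𝔤) :
    killingForm ℂ 𝔤 x ⁅y, z⁆ = killingForm ℂ 𝔤 y ⁅z, x⁆ := by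
  rw [killingForm_swap, killingForm_lie_left]

theorem killingPair_swap {t : 𝔤 ⊗[ℂ] 𝔤} (ht : t ∈ wedgeTwo 𝔤) (x y : 𝔤) :
    killingPair x y t = -killingPair y x t := by
  have h : ∀ t, killingPair y x (TensorProduct.comm ℂ 𝔤 𝔤 t) = killingPair x y t := by
    intro t
    induction t with
    | zero => simp
    | tmul a b => simp [mul_comm]
    | add s t hs ht => simp [hs, ht]
  rw [← h, mem_wedgeTwo.mp ht, map_neg]

theorem killingPair_lie (h x y : 𝔤) (t : 𝔤 ⊗[ℂ] 𝔤) :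
    killingPair x y ⁅h, t⁆ = -killingPair ⁅h, x⁆ y t - killingPair x ⁅h, y⁆ t := by
  have key : ∀ u v, killingForm ℂ 𝔤 u ⁅h, v⁆ = -killingForm ℂ 𝔤 ⁅h, u⁆ v := fun u v => by
    rw [← killingForm_lie_left, ← lie_skew, map_neg, LinearMap.neg_apply]
  induction t with
  | zero => simp
  | tmul a b =>
    rw [TensorProduct.LieModule.lie_tmul_right, map_add]
    simp only [killingPair_tmul, key]
    ring
  | add s t hs ht => simp only [lie_add, map_add, hs, ht]; ring

theorem killingTriple_wedgeLeft (x y z a : 𝔤) (t : 𝔤 ⊗[ℂ] 𝔤) :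
    killingTriple x y z (wedgeLeft 𝔤 (a ⊗ₜ t)) =
      killingForm ℂ 𝔤 x a * killingPair y z t - killingForm ℂ 𝔤 y a * killingPair x z t +
        killingForm ℂ 𝔤 z a * killingPair x y t := by
  induction t with
  | zero => simp
  | tmul b c =>
    rw [wedgeLeft_tmul]
    simp only [map_add, map_sub, killingTriple_tmul, killingPair_tmul]
    ring
  | add s t hs ht => simp only [tmul_add, map_add, hs, ht]; ring

theorem killingTriple_schouten (x y z : 𝔤) (s t : 𝔤 ⊗[ℂ] 𝔤) :
    killingTriple x y z (schouten 𝔤 s t) =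
      killingForm ℂ 𝔤 x ⁅contract y s, contract z t⁆ - killingForm ℂ 𝔤 x ⁅contract z s, contract y t⁆ +
      killingForm ℂ 𝔤 y ⁅contract z s, contract x t⁆ - killingForm ℂ 𝔤 y ⁅contract x s, contract z t⁆ +
      killingForm ℂ 𝔤 z ⁅contract x s, contract y t⁆ -
        killingForm ℂ 𝔤 z ⁅contract y s, contract x t⁆ := by
  induction s with
  | zero => simp
  | add s s' hs hs' => simp only [map_add, LinearMap.add_apply, hs, hs', add_lie]; ring
  | tmul a b =>
    induction t with
    | zero => simp
    | add s s' hs hs' => simp only [map_add, hs, hs', lie_add]; ring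
    | tmul c d =>
      rw [schouten_tmul, wedge₃]
      simp only [map_add, map_sub, killingTriple_tmul, killingPair_tmul, contract_tmul, smul_lie,
        lie_smul, map_smul, smul_eq_mul]
      ring

theorem killingTriple_schouten_self (x y z : 𝔤) (t : 𝔤 ⊗[ℂ] 𝔤) :
    killingTriple x y z (schouten 𝔤 t t) =
      2 * (killingForm ℂ 𝔤 x ⁅contract y t, contract z t⁆ +
        killingForm ℂ 𝔤 y ⁅contract z t, contract x t⁆ +
        killingForm ℂ 𝔤 z ⁅contract x t, contract y t⁆) := by
  rw [killingTriple_schouten, ← lie_skew (contract y t) (contract z t),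
    ← lie_skew (contract z t) (contract x t), ← lie_skew (contract x t) (contract y t)]
  simp only [map_neg]
  ring

variable [LieAlgebra.IsKilling ℂ 𝔤]

theorem eq_of_killingForm_eq {a b : 𝔤} (h : ∀ x, killingForm ℂ 𝔤 x a = killingForm ℂ 𝔤 x b) :
    a = b := by
  have := LieAlgebra.IsKilling.ker_killingForm_eq_bot ℂ 𝔤
  refine LinearMap.ker_eq_bot.mp this (LinearMap.ext fun x => ?_)
  rw [killingForm_swap, h, killingForm_swap]

variable [FiniteDimensional ℂ 𝔤]

-- The coordinates of a tensor in the product basis built from the Killing-dual basis are exactly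
-- such pairings.
open LinearMap.BilinForm in
theorem eq_zero_of_killingTriple_eq_zero {u : 𝔤 ⊗[ℂ] (𝔤 ⊗[ℂ] 𝔤)}
    (h : ∀ x y z, killingTriple x y z u = 0) : u = 0 := by
  let e := finBasis ℂ 𝔤
  let e' := LinearMap.BilinForm.dualBasis (killingForm ℂ 𝔤)
    (LieAlgebra.IsKilling.killingForm_nondegenerate ℂ 𝔤) e
  have h1 : ∀ x i, e'.repr x i = killingForm ℂ 𝔤 (e i) x := fun x i => by
    rw [killingForm_swap]; exact dualBasis_repr_apply _ _ _ _
  have h2 : ∀ t i j, (e'.tensorProduct e').repr t (i, j) = killingPair (e i) (e j) t := by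
    intro t i j
    induction t with
    | zero => simp
    | tmul a b => simp [h1, mul_comm]
    | add s t hs ht => simp [hs, ht]
  have h3 : ∀ u i j k, (e'.tensorProduct (e'.tensorProduct e')).repr u (i, (j, k)) =
      killingTriple (e i) (e j) (e k) u := by
    intro u i j k
    induction u with
    | zero => simp
    | tmul a b =>
      rw [Basis.tensorProduct_repr_tmul_apply, h1, h2, killingTriple_tmul, smul_eq_mul, mul_comm]
    | add s t hs ht => simp only [map_add, Finsupp.add_apply, hs, ht]
  refine (e'.tensorProduct (e'.tensorProduct e')).ext_elem fun ⟨i, j, k⟩ => ?_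
  rw [h3, h]; simp

open LinearMap.BilinForm in
theorem eq_zero_of_killingPair_eq_zero {t : 𝔤 ⊗[ℂ] 𝔤}
    (h : ∀ x y, killingPair x y t = 0) : t = 0 := by
  let e := finBasis ℂ 𝔤
  let e' := LinearMap.BilinForm.dualBasis (killingForm ℂ 𝔤)
    (LieAlgebra.IsKilling.killingForm_nondegenerate ℂ 𝔤) e
  have h1 : ∀ x i, e'.repr x i = killingForm ℂ 𝔤 (e i) x := fun x i => by
    rw [killingForm_swap]; exact dualBasis_repr_apply _ _ _ _
  have h2 : ∀ t i j, (e'.tensorProduct e').repr t (i, j) = killingPair (e i) (e j) t := by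
    intro t i j
    induction t with
    | zero => simp
    | tmul a b => simp [h1, mul_comm]
    | add s t hs ht => simp [hs, ht]
  refine (e'.tensorProduct e').ext_elem fun ⟨i, j⟩ => ?_
  rw [h2, h]; simp

-- Contracting either leg of the Casimir element with `x` returns `x` (`h1`, `h2`), so the pairing
-- collapses to `⟨y, [x, z]⟩`, and invariance does the rest.
open LinearMap.BilinForm in
theorem killingTriple_casimir (x y z : 𝔤) :
    killingTriple x y z (comm₁₂₂₃ 𝔤 (casimir 𝔤) (casimir 𝔤)) = -killingForm ℂ 𝔤 x ⁅y, z⁆ := by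
  let e := finBasis ℂ 𝔤
  let e' := LinearMap.BilinForm.dualBasis (killingForm ℂ 𝔤)
    (LieAlgebra.IsKilling.killingForm_nondegenerate ℂ 𝔤) e
  have h1 : ∀ x, ∑ i, killingForm ℂ 𝔤 x (e i) • e' i = x := fun x => by
    conv_rhs => rw [← e'.sum_repr x]
    exact Finset.sum_congr rfl fun i _ => by rw [dualBasis_repr_apply]
  have h2 : ∀ x, ∑ i, killingForm ℂ 𝔤 x (e' i) • e i = x := fun x => by
    refine eq_of_killingForm_eq fun w => ?_
    conv_rhs => rw [← h1 w]
    simp only [map_sum, map_smul, LinearMap.sum_apply, LinearMap.smul_apply, smul_eq_mul]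
    exact Finset.sum_congr rfl fun i _ => by rw [killingForm_swap x, mul_comm]
  have h3 : comm₁₂₂₃ 𝔤 (casimir 𝔤) (casimir 𝔤) =
      ∑ i, ∑ j, e i ⊗ₜ (⁅e' i, e j⁆ ⊗ₜ e' j) := by
    simp only [casimir, map_sum, LinearMap.sum_apply, comm₁₂₂₃_tmul]
    exact Finset.sum_comm
  have h4 : killingForm ℂ 𝔤 y ⁅∑ i, killingForm ℂ 𝔤 x (e i) • e' i,
      ∑ j, killingForm ℂ 𝔤 z (e' j) • e j⁆ =
      ∑ i, ∑ j, killingForm ℂ 𝔤 x (e i) *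
        (killingForm ℂ 𝔤 y ⁅e' i, e j⁆ * killingForm ℂ 𝔤 z (e' j)) := by
    simp only [sum_lie_sum, smul_lie, lie_smul, map_sum, map_smul, smul_eq_mul]
    refine Finset.sum_congr rfl fun i _ => Finset.sum_congr rfl fun j _ => ?_
    ring
  rw [h3]
  simp only [map_sum, killingTriple_tmul, killingPair_tmul]
  rw [← h4, h1, h2, ← killingForm_lie_cyclic, ← lie_skew, map_neg]
  congr 1
  rw [← killingForm_lie_cyclic, ← killingForm_lie_cyclic]

end Pairing

/-! ### Root vectors and the spanning set they form with the Cartan subalgebra. -/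

section RootVectors

open LieAlgebra LieModule LieAlgebra.IsKilling

variable {𝔤 : Type*} [LieRing 𝔤] [LieAlgebra ℂ 𝔤] [FiniteDimensional ℂ 𝔤]
  [LieAlgebra.IsKilling ℂ 𝔤] {H : LieSubalgebra ℂ 𝔤} [H.IsCartanSubalgebra]

theorem exists_eq_smul_of_mem_rootSpace {a : Weight ℂ H 𝔤} (ha : a.IsNonZero) {x y : 𝔤}
    (hx : x ∈ rootSpace H a) (hx0 : x ≠ 0) (hy : y ∈ rootSpace H a) : ∃ c : ℂ, c • x = y := by
  simpa using (finrank_eq_one_iff_of_nonzero' ⟨x, hx⟩ (by simpa using hx0)).mp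
      (finrank_rootSpace_eq_one _ ha) ⟨_, hy⟩

/-- The bracket of two root vectors is nonzero if the sum of their roots is a root. -/
theorem lie_ne_zero_of_mem_rootSpace {a b c : Weight ℂ H 𝔤} (ha : a.IsNonZero)
    (hb : b.IsNonZero) (habc : (c : H → ℂ) = a + b) {x y : 𝔤} (hx : x ∈ rootSpace H a)
    (hx0 : x ≠ 0) (hy : y ∈ rootSpace H b) (hy0 : y ≠ 0) : ⁅x, y⁆ ≠ 0 := by
  -- A vector `v` at the top of the `a`-string through `b` is primitive for the `sl₂`-triple of `a`.
  -- With `p + 1` the distance from `b` to the top, `f^(p+1) v` spans the root space of `b`.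
  obtain ⟨v, hv, hv0⟩ := (chainTop a b).exists_ne_zero
  obtain ⟨h, e, f, isSl2, he, hf⟩ := exists_isSl2Triple_of_weight_isNonZero ha
  obtain rfl := isSl2.h_eq_coroot ha he hf
  have prim : isSl2.HasPrimitiveVectorWith v (chainLength a b : ℂ) :=
    have := lie_mem_genWeightSpace_of_mem_genWeightSpace he hv
    ⟨hv0, (chainLength_smul _ _ hv).symm, by rwa [genWeightSpace_add_chainTop _ _ ha] at this⟩
  have hp := chainTopCoeff_le_chainLength a b
  have h1 : 1 ≤ chainTopCoeff a b := by
    have := (rootSpace_zsmul_add_ne_bot_iff a b ha 1).mp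
      (by rw [one_smul, ← habc]; exact c.genWeightSpace_ne_bot)
    exact_mod_cast this.1
  obtain ⟨p, hp'⟩ : ∃ p, chainTopCoeff a b = p + 1 := ⟨chainTopCoeff a b - 1, by omega⟩
  have hmem := toEnd_pow_apply_mem hf hv (p + 1)
  have hw0 := prim.pow_toEnd_f_ne_zero_of_eq_nat rfl (hp' ▸ hp)
  have hew := prim.lie_e_pow_succ_toEnd_f p
  have hu0 := prim.pow_toEnd_f_ne_zero_of_eq_nat rfl
    (show p ≤ chainLength a b by omega)
  have heq : (p + 1) • (-(a : H → ℂ)) + (chainTop a b : H → ℂ) = b := by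
    rw [coe_chainTop, hp']
    ext h
    simp
  rw [heq] at hmem
  obtain ⟨c₁, rfl⟩ := exists_eq_smul_of_mem_rootSpace ha he isSl2.e_ne_zero hx
  obtain ⟨c₂, rfl⟩ := exists_eq_smul_of_mem_rootSpace hb hmem hw0 hy
  -- The factor in `e f^(p+1) v = (p+1)(N-p) f^p v`, with `N` the length of the string; it is
  -- nonzero because `p + 1 ≤ N`.
  have hne : ((p : ℂ) + 1) * (chainLength a b - p) ≠ 0 := by
    refine mul_ne_zero (by exact_mod_cast p.succ_ne_zero) (sub_ne_zero.mpr ?_)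
    exact_mod_cast (show chainLength a b ≠ p by omega)
  rw [smul_lie, lie_smul, hew]
  exact smul_ne_zero (left_ne_zero_of_smul hx0) (smul_ne_zero (left_ne_zero_of_smul hy0)
    (smul_ne_zero hne hu0))

theorem killingForm_eq_zero_of_mem_rootSpace {a : Weight ℂ H 𝔤} (ha : a.IsNonZero) {x : 𝔤}
    (hx : x ∈ rootSpace H a) (h : H) : killingForm ℂ 𝔤 x h = 0 := by
  refine killingForm_apply_eq_zero_of_mem_rootSpace_of_add_ne_zero ℂ 𝔤 H hx (β := 0) ?_ ?_
  · simp
  · simpa using ha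

variable (H) in
/-- The functional `h ↦ ⟨x, h⟩` on the Cartan subalgebra. -/
def cartanRestrict : 𝔤 →ₗ[ℂ] Dual ℂ H :=
  (Dual.transpose H.toSubmodule.subtype) ∘ₗ (killingForm ℂ 𝔤)

@[simp] theorem cartanRestrict_apply (x : 𝔤) (h : H) :
    cartanRestrict H x h = killingForm ℂ 𝔤 x h := rfl

theorem cartanRestrict_coe (h : H) : cartanRestrict H (h : 𝔤) = cartanEquivDual H h := rfl

theorem cartanRestrict_of_mem_rootSpace {a : Weight ℂ H 𝔤} (ha : a.IsNonZero) {x : 𝔤}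
    (hx : x ∈ rootSpace H a) : cartanRestrict H x = 0 :=
  LinearMap.ext fun h => killingForm_eq_zero_of_mem_rootSpace ha hx h

variable {E : Weight ℂ H 𝔤 → 𝔤}
  (hE : ∀ a : Weight ℂ H 𝔤, a.IsNonZero → E a ∈ rootSpace H a)
  (hE_norm : ∀ a : Weight ℂ H 𝔤, a.IsNonZero → killingForm ℂ 𝔤 (E a) (E (-a)) = 1)

variable (E) in
/-- The Cartan subalgebra and the root vectors, a spanning set of `𝔤`. -/
def generators : Set 𝔤 := (H : Set 𝔤) ∪ {x | ∃ a : Weight ℂ H 𝔤, a.IsNonZero ∧ x = E a}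

include hE_norm in
theorem rootVector_ne_zero {a : Weight ℂ H 𝔤} (ha : a.IsNonZero) : E a ≠ 0 := by
  intro h
  simpa [h] using hE_norm a ha

include hE hE_norm in
theorem span_generators : Submodule.span ℂ (generators E) = ⊤ := by
  rw [eq_top_iff]
  rintro x -
  have hx : x ∈ ⨆ a : Weight ℂ H 𝔤, rootSpace H a := by
    rw [iSup_genWeightSpace_eq_top']; trivial
  induction hx using LieSubmodule.iSup_induction' with
  | mem a y hy =>
    by_cases ha : a.IsZero
    · refine Submodule.subset_span (Or.inl ?_)
      rw [ha.eq] at hy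
      simpa using hy
    · obtain ⟨c, rfl⟩ := exists_eq_smul_of_mem_rootSpace ha (hE a ha)
        (rootVector_ne_zero hE_norm ha) hy
      exact Submodule.smul_mem _ _ (Submodule.subset_span (Or.inr ⟨a, ha, rfl⟩))
  | zero => exact zero_mem _
  | add y z _ _ hy hz => exact add_mem hy hz

include hE hE_norm in
theorem linearMap_eq_zero_of_generators {f : 𝔤 →ₗ[ℂ] ℂ} (hf : ∀ x ∈ generators E, f x = 0)
    (x : 𝔤) : f x = 0 := by
  have : f = 0 := LinearMap.ext_on (span_generators hE hE_norm) fun x hx => by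
    simpa using hf x hx
  rw [this, LinearMap.zero_apply]

-- The pairing is linear in each argument, and each of the three functionals below frees one
-- argument while the other two stay fixed.
include hE hE_norm in
theorem eq_zero_of_killingTriple_generators {u : 𝔤 ⊗[ℂ] (𝔤 ⊗[ℂ] 𝔤)}
    (h : ∀ x ∈ generators E, ∀ y ∈ generators E, ∀ z ∈ generators E, killingTriple x y z u = 0) :
    u = 0 := by
  refine eq_zero_of_killingTriple_eq_zero fun x y z => ?_
  have key := fun f => linearMap_eq_zero_of_generators hE hE_norm (f := f)
  refine key ((LinearMap.flip
    (TensorProduct.dualDistrib ℂ 𝔤 (𝔤 ⊗[ℂ] 𝔤) ∘ₗ (TensorProduct.mk ℂ _ _).flip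
      (killingPair y z)) u) ∘ₗ killingForm ℂ 𝔤) (fun x hx => ?_) x
  refine key ((LinearMap.flip
    (TensorProduct.dualDistrib ℂ 𝔤 (𝔤 ⊗[ℂ] 𝔤) ∘ₗ TensorProduct.mk ℂ _ _ (killingForm ℂ 𝔤 x) ∘ₗ
      TensorProduct.dualDistrib ℂ 𝔤 𝔤 ∘ₗ (TensorProduct.mk ℂ _ _).flip
      (killingForm ℂ 𝔤 z)) u) ∘ₗ killingForm ℂ 𝔤) (fun y hy => ?_) y
  exact key ((LinearMap.flip
    (TensorProduct.dualDistrib ℂ 𝔤 (𝔤 ⊗[ℂ] 𝔤) ∘ₗ TensorProduct.mk ℂ _ _ (killingForm ℂ 𝔤 x) ∘ₗ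
      TensorProduct.dualDistrib ℂ 𝔤 𝔤 ∘ₗ TensorProduct.mk ℂ _ _
      (killingForm ℂ 𝔤 y)) u) ∘ₗ killingForm ℂ 𝔤) (fun z hz => h x hx y hy z hz) z

include hE hE_norm in
theorem eq_zero_of_killingPair_generators {t : 𝔤 ⊗[ℂ] 𝔤}
    (h : ∀ x ∈ generators E, ∀ y ∈ generators E, killingPair x y t = 0) : t = 0 := by
  refine eq_zero_of_killingPair_eq_zero fun x y => ?_
  have key := fun f => linearMap_eq_zero_of_generators hE hE_norm (f := f)
  refine key ((LinearMap.flip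
    (TensorProduct.dualDistrib ℂ 𝔤 𝔤 ∘ₗ (TensorProduct.mk ℂ _ _).flip
      (killingForm ℂ 𝔤 y)) t) ∘ₗ killingForm ℂ 𝔤) (fun x hx => ?_) x
  exact key ((LinearMap.flip
    (TensorProduct.dualDistrib ℂ 𝔤 𝔤 ∘ₗ TensorProduct.mk ℂ _ _
      (killingForm ℂ 𝔤 x)) t) ∘ₗ killingForm ℂ 𝔤) (fun y hy => h x hx y hy) y

end RootVectors

/-! ### The dynamical Yang-Baxter equation in components. -/

section CDYBE

open LieAlgebra LieModule LieAlgebra.IsKilling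

variable {𝔤 : Type*} [LieRing 𝔤] [LieAlgebra ℂ 𝔤] [FiniteDimensional ℂ 𝔤]
  [LieAlgebra.IsKilling ℂ 𝔤] {H : LieSubalgebra ℂ 𝔤} [H.IsCartanSubalgebra]

variable (H) in
/-- The skew-symmetric tensors of weight zero. -/
def zeroWeightSkew : Submodule ℂ (𝔤 ⊗[ℂ] 𝔤) where
  carrier := {t | t ∈ wedgeTwo 𝔤 ∧ ∀ h : H, ⁅(h : 𝔤), t⁆ = 0}
  add_mem' := fun hs ht => ⟨add_mem hs.1 ht.1, fun h => by rw [lie_add, hs.2, ht.2, add_zero]⟩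
  zero_mem' := ⟨zero_mem _, fun h => lie_zero _⟩
  smul_mem' := fun c t ht => ⟨Submodule.smul_mem _ c ht.1, fun h => by
    rw [lie_smul, ht.2, smul_zero]⟩

/-- The coefficient of `E_α ⊗ E_{-α}` in a tensor. -/
def rootCoeff (E : Weight ℂ H 𝔤 → 𝔤) (a : Weight ℂ H 𝔤) : 𝔤 ⊗[ℂ] 𝔤 →ₗ[ℂ] ℂ :=
  killingPair (E (-a)) (E a)

/-- By invariance `h` acts on the pairing through the scalar `(a + b)(h)`, while it annihilates `t`.
-/
theorem killingPair_eq_zero_of_add_ne_zero {t : 𝔤 ⊗[ℂ] 𝔤} (ht : t ∈ zeroWeightSkew H)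
    {a b : H → ℂ} (hab : a + b ≠ 0) {x y : 𝔤} (hx : x ∈ rootSpace H a) (hy : y ∈ rootSpace H b) :
    killingPair x y t = 0 := by
  obtain ⟨h, hh⟩ := Function.ne_iff.mp hab
  have h1 := killingPair_lie (h : 𝔤) x y t
  have hx' : ⁅(h : 𝔤), x⁆ = a h • x := lie_eq_smul_of_mem_rootSpace hx h
  have hy' : ⁅(h : 𝔤), y⁆ = b h • y := lie_eq_smul_of_mem_rootSpace hy h
  rw [ht.2, map_zero, hx', hy', killingPair_smul_left, killingPair_smul_right] at h1
  have h2 : (a h + b h) * killingPair x y t = 0 := by linear_combination h1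
  exact (mul_eq_zero.mp h2).resolve_left hh

theorem coe_mem_rootSpace_zero (h : H) : (h : 𝔤) ∈ rootSpace H (0 : H → ℂ) := by simp

variable {E : Weight ℂ H 𝔤 → 𝔤}
  (hE : ∀ a : Weight ℂ H 𝔤, a.IsNonZero → E a ∈ rootSpace H a)
  (hE_norm : ∀ a : Weight ℂ H 𝔤, a.IsNonZero → killingForm ℂ 𝔤 (E a) (E (-a)) = 1)

theorem eq_neg_of_coe_add_eq_zero {a b : Weight ℂ H 𝔤} (h : (a : H → ℂ) + b = 0) : b = -a := by
  ext x
  exact eq_neg_of_add_eq_zero_right (congrFun h x)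

theorem rootCoeff_neg {t : 𝔤 ⊗[ℂ] 𝔤} (ht : t ∈ wedgeTwo 𝔤) (a : Weight ℂ H 𝔤) :
    rootCoeff E (-a) t = -rootCoeff E a t := by
  rw [rootCoeff, rootCoeff, neg_neg, killingPair_swap ht]

include hE in
theorem killingPair_rootVector_coe {t : 𝔤 ⊗[ℂ] 𝔤} (ht : t ∈ zeroWeightSkew H)
    {a : Weight ℂ H 𝔤} (ha : a.IsNonZero) (h : H) : killingPair (E a) (h : 𝔤) t = 0 :=
  killingPair_eq_zero_of_add_ne_zero ht (by simpa using ha) (hE a ha) (coe_mem_rootSpace_zero h)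

include hE in
theorem killingPair_coe_rootVector {t : 𝔤 ⊗[ℂ] 𝔤} (ht : t ∈ zeroWeightSkew H)
    {a : Weight ℂ H 𝔤} (ha : a.IsNonZero) (h : H) : killingPair (h : 𝔤) (E a) t = 0 :=
  killingPair_eq_zero_of_add_ne_zero ht (by simpa using ha) (coe_mem_rootSpace_zero h) (hE a ha)

-- Contraction with a tensor of weight zero preserves weights, and root spaces are lines, so each
-- root vector is an eigenvector.
include hE hE_norm in
theorem contract_rootVector {t : 𝔤 ⊗[ℂ] 𝔤} (ht : t ∈ zeroWeightSkew H)
    {a : Weight ℂ H 𝔤} (ha : a.IsNonZero) : contract (E a) t = rootCoeff E a t • E a := by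
  rw [← sub_eq_zero]
  refine eq_of_killingForm_eq fun x => ?_
  rw [map_zero]
  rw [killingForm_swap]
  refine linearMap_eq_zero_of_generators hE hE_norm
    (f := killingForm ℂ 𝔤 (contract (E a) t - rootCoeff E a t • E a)) ?_ x
  have h0 : ∀ x, killingForm ℂ 𝔤 (contract (E a) t - rootCoeff E a t • E a) x =
      killingPair x (E a) t - rootCoeff E a t * killingForm ℂ 𝔤 x (E a) := fun x => by
    rw [killingForm_swap, map_sub, map_smul, killingForm_contract, smul_eq_mul]
  simp only [h0]
  rintro _ (hx | ⟨b, hb, rfl⟩)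
  · rw [killingPair_coe_rootVector hE ht ha ⟨_, hx⟩, killingForm_swap,
      killingForm_eq_zero_of_mem_rootSpace ha (hE a ha) ⟨_, hx⟩, mul_zero, sub_zero]
  · by_cases hab : (a : H → ℂ) + b = 0
    · obtain rfl := eq_neg_of_coe_add_eq_zero hab
      rw [killingForm_swap, hE_norm a ha, mul_one, rootCoeff, sub_self]
    · rw [add_comm] at hab
      rw [killingPair_eq_zero_of_add_ne_zero ht hab (hE b hb) (hE a ha),
        killingForm_apply_eq_zero_of_mem_rootSpace_of_add_ne_zero ℂ 𝔤 H (hE b hb) (hE a ha) hab,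
        mul_zero, sub_zero]

theorem lie_coe_coe (h h' : H) : ⁅(h : 𝔤), (h' : 𝔤)⁆ = 0 := by
  rw [← LieSubalgebra.coe_bracket, trivial_lie_zero]; rfl

/-- The contraction commutes with the action of `𝔥`, so it sends `𝔥` into the centralizer of `𝔥`,
which is `𝔥` itself. -/
theorem contract_coe_mem {t : 𝔤 ⊗[ℂ] 𝔤} (ht : t ∈ zeroWeightSkew H) (h : H) :
    contract (h : 𝔤) t ∈ H := by
  refine (zeroRootSubalgebra_eq_of_is_cartan ℂ 𝔤 H).le ?_
  rw [mem_zeroRootSubalgebra]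
  refine fun y => ⟨1, ?_⟩
  rw [pow_one]
  change ⁅(y : 𝔤), _⁆ = _
  refine eq_of_killingForm_eq fun x => ?_
  have h1 := killingPair_lie (y : 𝔤) x h t
  have h2 : killingPair x (0 : 𝔤) t = 0 := by simp [killingPair]
  rw [ht.2, lie_coe_coe, map_zero, h2, sub_zero, eq_comm, neg_eq_zero] at h1
  rw [← killingForm_lie_left, killingForm_contract, map_zero, ← lie_skew, ← neg_one_smul ℂ,
    killingPair_smul_left, h1, mul_zero]

/-- `D` stands for the differential of `r` at a point. Keeping it an abstract linear map turns the
component analysis into pure algebra. -/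
theorem sum_wedgeLeft_killingTriple (D : Dual ℂ H →ₗ[ℂ] 𝔤 ⊗[ℂ] 𝔤) (hD : ∀ v, D v ∈ wedgeTwo 𝔤)
    (x y z : 𝔤) :
    killingTriple x y z
      (∑ i, wedgeLeft 𝔤 ((finBasis ℂ H i : 𝔤) ⊗ₜ[ℂ] D ((finBasis ℂ H).coord i))) =
    killingPair y z (D (cartanRestrict H x)) + killingPair z x (D (cartanRestrict H y)) +
      killingPair x y (D (cartanRestrict H z)) := by
  have h1 : ∀ w : 𝔤, cartanRestrict H w =
      ∑ i, killingForm ℂ 𝔤 w (finBasis ℂ H i) • (finBasis ℂ H).coord i := fun w => by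
    refine (finBasis ℂ H).ext fun j => ?_
    simp [Finsupp.single_apply]
  rw [killingPair_swap (hD _) z x]
  simp only [h1, map_sum, map_smul, smul_eq_mul, killingTriple_wedgeLeft, Finset.sum_add_distrib,
    Finset.sum_sub_distrib]
  ring

theorem cdybe_killingTriple (D : Dual ℂ H →ₗ[ℂ] 𝔤 ⊗[ℂ] 𝔤) (hD : ∀ v, D v ∈ wedgeTwo 𝔤)
    (t : 𝔤 ⊗[ℂ] 𝔤) (x y z : 𝔤) :
    killingTriple x y z
      (∑ i, wedgeLeft 𝔤 ((finBasis ℂ H i : 𝔤) ⊗ₜ[ℂ] D ((finBasis ℂ H).coord i)) +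
        (1 / 2 : ℂ) • schouten 𝔤 t t - ((2 : ℂ) ^ 2 / 4) • comm₁₂₂₃ 𝔤 (casimir 𝔤) (casimir 𝔤)) =
    killingPair y z (D (cartanRestrict H x)) + killingPair z x (D (cartanRestrict H y)) +
      killingPair x y (D (cartanRestrict H z)) +
      (killingForm ℂ 𝔤 x ⁅contract y t, contract z t⁆ +
        killingForm ℂ 𝔤 y ⁅contract z t, contract x t⁆ +
        killingForm ℂ 𝔤 z ⁅contract x t, contract y t⁆) + killingForm ℂ 𝔤 x ⁅y, z⁆ := by
  rw [map_sub, map_add, map_smul, map_smul, sum_wedgeLeft_killingTriple D hD,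
    killingTriple_schouten_self, killingTriple_casimir]
  simp only [smul_eq_mul]
  ring

section Components

variable {D : Dual ℂ H →ₗ[ℂ] 𝔤 ⊗[ℂ] 𝔤} (hD : ∀ v, D v ∈ zeroWeightSkew H)
  {t : 𝔤 ⊗[ℂ] 𝔤} (ht : t ∈ zeroWeightSkew H)

/-- The left-hand side minus the right-hand side of the classical dynamical Yang-Baxter equation,
for a tensor `t` and a derivative `D`. -/
def cdybeDefect (D : Dual ℂ H →ₗ[ℂ] 𝔤 ⊗[ℂ] 𝔤) (t : 𝔤 ⊗[ℂ] 𝔤) : 𝔤 ⊗[ℂ] (𝔤 ⊗[ℂ] 𝔤) :=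
  ∑ i, wedgeLeft 𝔤 ((finBasis ℂ H i : 𝔤) ⊗ₜ[ℂ] D ((finBasis ℂ H).coord i)) +
    (1 / 2 : ℂ) • schouten 𝔤 t t - ((2 : ℂ) ^ 2 / 4) • comm₁₂₂₃ 𝔤 (casimir 𝔤) (casimir 𝔤)

-- Cyclic symmetry lets one ordering stand for its rotations when the triples of generators are
-- enumerated.
include hD in
theorem cdybeDefect_cyclic (x y z : 𝔤) :
    killingTriple x y z (cdybeDefect D t) = killingTriple y z x (cdybeDefect D t) := by
  rw [cdybeDefect, cdybe_killingTriple D (fun v => (hD v).1),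
    cdybe_killingTriple D (fun v => (hD v).1), killingForm_lie_cyclic x y z]
  ring

-- Contractions of Cartan elements stay in the abelian algebra `𝔥`, so every bracket term drops out
-- and only the closedness expression is left.
include hD ht in
theorem cdybeDefect_coe_coe_coe (h h' h'' : H) :
    killingTriple (h : 𝔤) (h' : 𝔤) (h'' : 𝔤) (cdybeDefect D t) =
      killingPair (h' : 𝔤) (h'' : 𝔤) (D (cartanEquivDual H h)) +
        killingPair (h'' : 𝔤) (h : 𝔤) (D (cartanEquivDual H h')) +
        killingPair (h : 𝔤) (h' : 𝔤) (D (cartanEquivDual H h'')) := by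
  have h0 : ∀ k k' : H, ⁅contract (k : 𝔤) t, contract (k' : 𝔤) t⁆ = 0 := fun k k' =>
    lie_coe_coe (⟨_, contract_coe_mem ht k⟩ : H) ⟨_, contract_coe_mem ht k'⟩
  rw [cdybeDefect, cdybe_killingTriple D (fun v => (hD v).1)]
  simp [h0, lie_coe_coe, cartanRestrict_coe]

include hE hE_norm hD ht

/-- Root vectors are orthogonal to `𝔥`, which removes the derivative terms. The contractions only
rescale, so a common factor `⟨E_a, [E_b, E_c]⟩` comes out. -/
theorem cdybeDefect_root_root_root {a b c : Weight ℂ H 𝔤} (ha : a.IsNonZero) (hb : b.IsNonZero)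
    (hc : c.IsNonZero) :
    killingTriple (E a) (E b) (E c) (cdybeDefect D t) =
      (rootCoeff E a t * rootCoeff E b t + rootCoeff E b t * rootCoeff E c t +
        rootCoeff E c t * rootCoeff E a t + 1) * killingForm ℂ 𝔤 (E a) ⁅E b, E c⁆ := by
  rw [cdybeDefect, cdybe_killingTriple D (fun v => (hD v).1),
    contract_rootVector hE hE_norm ht ha, contract_rootVector hE hE_norm ht hb,
    contract_rootVector hE hE_norm ht hc, cartanRestrict_of_mem_rootSpace ha (hE a ha),
    cartanRestrict_of_mem_rootSpace hb (hE b hb), cartanRestrict_of_mem_rootSpace hc (hE c hc)]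
  simp only [map_zero, smul_lie, lie_smul, map_smul, smul_eq_mul]
  rw [killingForm_lie_cyclic (E c), ← killingForm_lie_cyclic (E a) (E b)]
  ring

theorem cdybeDefect_coe_coe_root (h h' : H) {a : Weight ℂ H 𝔤} (ha : a.IsNonZero) :
    killingTriple (h : 𝔤) (h' : 𝔤) (E a) (cdybeDefect D t) = 0 := by
  have h0 : ∀ k k' : H, ⁅contract (k : 𝔤) t, contract (k' : 𝔤) t⁆ = 0 := fun k k' =>
    lie_coe_coe (⟨_, contract_coe_mem ht k⟩ : H) ⟨_, contract_coe_mem ht k'⟩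
  have hw : ∀ k : H, ⁅(k : 𝔤), E a⁆ = a k • E a := fun k =>
    lie_eq_smul_of_mem_rootSpace (hE a ha) k
  have h1 : ∀ k k' : H, killingForm ℂ 𝔤 (k : 𝔤) ⁅contract (k' : 𝔤) t, E a⁆ = 0 := fun k k' => by
    rw [← killingForm_lie_cyclic, ← killingForm_lie_left, ← lie_skew, hw, map_neg,
      LinearMap.neg_apply, map_smul, LinearMap.smul_apply, killingForm_contract,
      killingPair_rootVector_coe hE ht ha, smul_zero, neg_zero]
  have h2 : killingForm ℂ 𝔤 (h : 𝔤) ⁅(h' : 𝔤), E a⁆ = 0 := by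
    rw [← killingForm_lie_left, lie_coe_coe, map_zero, LinearMap.zero_apply]
  have h3 : ∀ k k' : H, killingForm ℂ 𝔤 (k : 𝔤) ⁅E a, contract (k' : 𝔤) t⁆ = 0 := fun k k' => by
    rw [← lie_skew, map_neg, h1, neg_zero]
  rw [cdybeDefect, cdybe_killingTriple D (fun v => (hD v).1),
    cartanRestrict_of_mem_rootSpace ha (hE a ha), contract_rootVector hE hE_norm ht ha,
    killingPair_rootVector_coe hE (hD _) ha, killingPair_coe_rootVector hE (hD _) ha, h0, h2]
  simp [h1, h3]

theorem cdybeDefect_coe_root_root_of_add_ne_zero (h : H) {a b : Weight ℂ H 𝔤} (ha : a.IsNonZero)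
    (hb : b.IsNonZero) (hab : (a : H → ℂ) + b ≠ 0) :
    killingTriple (h : 𝔤) (E a) (E b) (cdybeDefect D t) = 0 := by
  have hlie : ⁅E a, E b⁆ ∈ rootSpace H ((a : H → ℂ) + b) :=
    lie_mem_genWeightSpace_of_mem_genWeightSpace (hE a ha) (hE b hb)
  have h1 : killingForm ℂ 𝔤 (h : 𝔤) ⁅E a, E b⁆ = 0 := by
    refine killingForm_apply_eq_zero_of_mem_rootSpace_of_add_ne_zero ℂ 𝔤 H
      (coe_mem_rootSpace_zero h) hlie (by simpa using hab)
  have h2 : killingForm ℂ 𝔤 (E a) ⁅E b, contract (h : 𝔤) t⁆ = 0 := by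
    rw [← killingForm_lie_left, killingForm_contract]
    exact killingPair_eq_zero_of_add_ne_zero ht (by simpa using hab) hlie
      (coe_mem_rootSpace_zero h)
  have h3 : killingForm ℂ 𝔤 (E b) ⁅contract (h : 𝔤) t, E a⁆ = 0 := by
    rw [← killingForm_lie_cyclic, h2]
  rw [cdybeDefect, cdybe_killingTriple D (fun v => (hD v).1),
    cartanRestrict_of_mem_rootSpace ha (hE a ha), cartanRestrict_of_mem_rootSpace hb (hE b hb),
    contract_rootVector hE hE_norm ht ha, contract_rootVector hE hE_norm ht hb,
    killingPair_eq_zero_of_add_ne_zero (hD _) hab (hE a ha) (hE b hb)]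
  simp [h1, h2, h3]

/-- This component is the Riccati equation. The two terms that contract `h` cancel, the remaining
bracket term gives `-φ_a² a(h)` since `φ_{-a} = -φ_a`, and the Casimir term gives `a(h)`. -/
theorem cdybeDefect_coe_root_neg (h : H) {a : Weight ℂ H 𝔤} (ha : a.IsNonZero) :
    killingTriple (h : 𝔤) (E a) (E (-a)) (cdybeDefect D t) =
      (1 - rootCoeff E a t ^ 2) * a h - rootCoeff E a (D (cartanEquivDual H h)) := by
  have ha' : (-a).IsNonZero := by simpa using ha
  have h1 : killingForm ℂ 𝔤 (h : 𝔤) ⁅E a, E (-a)⁆ = a h := by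
    have : ⁅(h : 𝔤), E a⁆ = a h • E a := lie_eq_smul_of_mem_rootSpace (hE a ha) h
    rw [← killingForm_lie_left, this, map_smul, LinearMap.smul_apply, hE_norm a ha, smul_eq_mul,
      mul_one]
  have h2 : killingForm ℂ 𝔤 (E (-a)) ⁅contract (h : 𝔤) t, E a⁆ =
      killingForm ℂ 𝔤 (E a) ⁅E (-a), contract (h : 𝔤) t⁆ := by
    rw [← killingForm_lie_cyclic]
  rw [cdybeDefect, cdybe_killingTriple D (fun v => (hD v).1),
    cartanRestrict_of_mem_rootSpace ha (hE a ha), cartanRestrict_of_mem_rootSpace ha' (hE _ ha'),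
    contract_rootVector hE hE_norm ht ha, contract_rootVector hE hE_norm ht ha',
    rootCoeff_neg ht.1, killingPair_swap (hD _).1, cartanRestrict_coe]
  simp only [map_zero, smul_lie, lie_smul, map_smul, smul_eq_mul, h1, h2, neg_smul, neg_lie,
    lie_neg, map_neg, rootCoeff]
  ring

theorem cdybe_iff :
    ∑ i, wedgeLeft 𝔤 ((finBasis ℂ H i : 𝔤) ⊗ₜ[ℂ] D ((finBasis ℂ H).coord i)) +
      (1 / 2 : ℂ) • schouten 𝔤 t t = ((2 : ℂ) ^ 2 / 4) • comm₁₂₂₃ 𝔤 (casimir 𝔤) (casimir 𝔤) ↔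
    (∀ a : Weight ℂ H 𝔤, a.IsNonZero → ∀ h : H,
      rootCoeff E a (D (cartanEquivDual H h)) = (1 - rootCoeff E a t ^ 2) * a h) ∧
    (∀ a b c : Weight ℂ H 𝔤, a.IsNonZero → b.IsNonZero → c.IsNonZero →
      (a : H → ℂ) + b + c = 0 → rootCoeff E a t * rootCoeff E b t +
        rootCoeff E b t * rootCoeff E c t + rootCoeff E c t * rootCoeff E a t = -1) ∧
    ∀ h h' h'' : H, killingPair (h' : 𝔤) (h'' : 𝔤) (D (cartanEquivDual H h)) +
        killingPair (h'' : 𝔤) (h : 𝔤) (D (cartanEquivDual H h')) +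
        killingPair (h : 𝔤) (h' : 𝔤) (D (cartanEquivDual H h'')) = 0 := by
  rw [← sub_eq_zero]
  change cdybeDefect D t = 0 ↔ _
  constructor
  · intro h0
    refine ⟨fun a ha h => ?_, fun a b c ha hb hc habc => ?_, fun h h' h'' => ?_⟩
    · have := cdybeDefect_coe_root_neg hE hE_norm hD ht h ha
      rw [h0, map_zero] at this
      linear_combination this
    · have := cdybeDefect_root_root_root hE hE_norm hD ht ha hb hc
      rw [h0, map_zero, eq_comm, mul_eq_zero] at this
      -- The common factor can be divided out: `[E_b, E_c]` is a nonzero multiple of `E_{-a}`.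
      refine eq_neg_of_add_eq_zero_left (this.resolve_right fun h1 => ?_)
      have ha' : (-a).IsNonZero := by simpa using ha
      have hbc : ((-a : Weight ℂ H 𝔤) : H → ℂ) = b + c := by
        rw [Weight.coe_neg, ← add_eq_zero_iff_neg_eq, ← add_assoc, habc]
      have hmem : ⁅E b, E c⁆ ∈ rootSpace H (-a : Weight ℂ H 𝔤) := by
        rw [hbc]; exact lie_mem_genWeightSpace_of_mem_genWeightSpace (hE b hb) (hE c hc)
      obtain ⟨k, hk⟩ := exists_eq_smul_of_mem_rootSpace ha' (hE _ ha')
        (rootVector_ne_zero hE_norm ha') hmem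
      rw [← hk, map_smul, hE_norm a ha, smul_eq_mul, mul_one] at h1
      refine lie_ne_zero_of_mem_rootSpace hb hc hbc (hE b hb) (rootVector_ne_zero hE_norm hb)
        (hE c hc) (rootVector_ne_zero hE_norm hc) ?_
      rw [← hk, h1, zero_smul]
    · rw [← cdybeDefect_coe_coe_coe hD ht, h0, map_zero]
  · rintro ⟨hA, hB, hC⟩
    have hroot : ∀ (h : H) (a b : Weight ℂ H 𝔤), a.IsNonZero → b.IsNonZero →
        killingTriple (h : 𝔤) (E a) (E b) (cdybeDefect D t) = 0 := fun h a b ha hb => by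
      by_cases hab : (a : H → ℂ) + b = 0
      · obtain rfl := eq_neg_of_coe_add_eq_zero hab
        rw [cdybeDefect_coe_root_neg hE hE_norm hD ht h ha, hA a ha, sub_self]
      · exact cdybeDefect_coe_root_root_of_add_ne_zero hE hE_norm hD ht h ha hb hab
    refine eq_zero_of_killingTriple_generators hE hE_norm ?_
    rintro x (hx | ⟨a, ha, rfl⟩) y (hy | ⟨b, hb, rfl⟩) z (hz | ⟨c, hc, rfl⟩)
    · rw [cdybeDefect_coe_coe_coe hD ht ⟨x, hx⟩ ⟨y, hy⟩ ⟨z, hz⟩, hC]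
    · exact cdybeDefect_coe_coe_root hE hE_norm hD ht ⟨x, hx⟩ ⟨y, hy⟩ hc
    · rw [← cdybeDefect_cyclic hD]
      exact cdybeDefect_coe_coe_root hE hE_norm hD ht ⟨z, hz⟩ ⟨x, hx⟩ hb
    · exact hroot ⟨x, hx⟩ b c hb hc
    · rw [cdybeDefect_cyclic hD]
      exact cdybeDefect_coe_coe_root hE hE_norm hD ht ⟨y, hy⟩ ⟨z, hz⟩ ha
    · rw [cdybeDefect_cyclic hD]
      exact hroot ⟨y, hy⟩ c a hc ha
    · rw [← cdybeDefect_cyclic hD]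
      exact hroot ⟨z, hz⟩ a b ha hb
    · rw [cdybeDefect_root_root_root hE hE_norm hD ht ha hb hc]
      by_cases habc : (a : H → ℂ) + b + c = 0
      · rw [hB a b c ha hb hc habc, neg_add_cancel, zero_mul]
      · rw [killingForm_apply_eq_zero_of_mem_rootSpace_of_add_ne_zero ℂ 𝔤 H (hE a ha)
          (lie_mem_genWeightSpace_of_mem_genWeightSpace (hE b hb) (hE c hc))
          (by rwa [← add_assoc]), mul_zero]

end Components

end CDYBE

/-! ### Bases, faces of the positive cone and parabolic sets of roots. -/

section Parabolic

variable {ι R M N : Type*} [Finite ι] [Field R] [CharZero R] [AddCommGroup M] [Module R M]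
  [AddCommGroup N] [Module R N] {P : RootPairing ι R M N} [P.IsRootSystem]

/-- The cone generated by a subset of the simple roots is a face of the positive cone. -/
theorem exists_face_functional (b : P.Base) {S : Set ι} (hS : S ⊆ b.support) :
    ∃ f : M →ₗ[R] R, (∀ x ∈ AddSubmonoid.closure (P.root '' b.support), ∃ n : ℕ, f x = n ∧
      (n = 0 → x ∈ AddSubmonoid.closure (P.root '' S))) ∧
      (∀ x ∈ AddSubmonoid.closure (P.root '' S), f x = 0) ∧
      ∀ i ∈ b.support, f (P.root i) = 0 → i ∈ S := by
  classical
  -- `f` is the sum of the coefficients at the simple roots outside `S`; on the positive cone it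
  -- takes natural values and vanishes exactly on the face of `S`.
  let f : M →ₗ[R] R := b.toWeightBasis.constr R fun i => if (i : ι) ∈ S then 0 else 1
  have hf : ∀ i ∈ b.support, f (P.root i) = if i ∈ S then 0 else 1 := fun i hi => by
    have := b.toWeightBasis.constr_basis R (fun i => if (i : ι) ∈ S then (0 : R) else 1) ⟨i, hi⟩
    rwa [b.toWeightBasis_apply] at this
  refine ⟨f, fun x hx => ?_, fun x hx => ?_, fun i hi h => ?_⟩
  · induction hx using AddSubmonoid.closure_induction with
    | mem x hx =>
      obtain ⟨i, hi, rfl⟩ := hx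
      by_cases hiS : i ∈ S
      · exact ⟨0, by simp [hf i hi, hiS], fun _ => AddSubmonoid.subset_closure ⟨i, hiS, rfl⟩⟩
      · exact ⟨1, by simp [hf i hi, hiS], by simp⟩
    | zero => exact ⟨0, by simp, fun _ => zero_mem _⟩
    | add x y _ _ hx hy =>
      obtain ⟨n, hn, hn'⟩ := hx
      obtain ⟨m, hm, hm'⟩ := hy
      exact ⟨n + m, by simp [hn, hm], fun h => add_mem (hn' (by omega)) (hm' (by omega))⟩
  · induction hx using AddSubmonoid.closure_induction with
    | mem x hx =>
      obtain ⟨i, hi, rfl⟩ := hx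
      simp [hf i (hS hi), hi]
    | zero => simp
    | add x y _ _ hx hy => simp [hx, hy]
  · by_contra hiS
    simp [hf i hi, hiS] at h

/-- The functional of the face is natural-valued on both summands, so a zero sum forces both values
to be zero. -/
theorem mem_closure_of_add_mem_closure (b : P.Base) {S : Set ι} (hS : S ⊆ b.support) {x y : M}
    (hx : x ∈ AddSubmonoid.closure (P.root '' b.support))
    (hy : y ∈ AddSubmonoid.closure (P.root '' b.support))
    (hxy : x + y ∈ AddSubmonoid.closure (P.root '' S)) :
    x ∈ AddSubmonoid.closure (P.root '' S) ∧ y ∈ AddSubmonoid.closure (P.root '' S) := by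
  obtain ⟨f, hf, hf0, -⟩ := exists_face_functional b hS
  obtain ⟨n, hn, hn'⟩ := hf x hx
  obtain ⟨m, hm, hm'⟩ := hf y hy
  have h := hf0 _ hxy
  rw [map_add, hn, hm] at h
  have h' : n + m = 0 := by exact_mod_cast h
  exact ⟨hn' (by omega), hm' (by omega)⟩

theorem mem_of_root_mem_closure (b : P.Base) {S : Set ι} (hS : S ⊆ b.support) {i : ι}
    (hi : i ∈ b.support) (h : P.root i ∈ AddSubmonoid.closure (P.root '' S)) : i ∈ S := by
  obtain ⟨f, -, hf0, hf⟩ := exists_face_functional b hS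
  exact hf i hi (hf0 _ h)

variable [P.IsCrystallographic]

theorem isPos_iff_mem_closure (b : P.Base) {i : ι} :
    b.IsPos i ↔ P.root i ∈ AddSubmonoid.closure (P.root '' b.support) := by
  constructor
  · intro h
    refine h.induction_on_add (p := fun i => P.root i ∈ AddSubmonoid.closure (P.root '' b.support))
      (fun i hi => AddSubmonoid.subset_closure ⟨i, hi, rfl⟩) fun i j k hk hi hj => ?_
    rw [hk]
    exact add_mem hi (AddSubmonoid.subset_closure ⟨j, hj, rfl⟩)
  · intro h
    by_contra hpos
    have hneg : b.IsPos (P.reflectionPerm i i) := (RootPairing.Base.IsPos.neg_iff_not b i).mpr hpos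
    have h' : P.root (P.reflectionPerm i i) ∈ AddSubmonoid.closure (P.root '' b.support) := by
      refine hneg.induction_on_add
        (p := fun i => P.root i ∈ AddSubmonoid.closure (P.root '' b.support))
        (fun i hi => AddSubmonoid.subset_closure ⟨i, hi, rfl⟩) fun i j k hk hi hj => ?_
      rw [hk]
      exact add_mem hi (AddSubmonoid.subset_closure ⟨j, hj, rfl⟩)
    -- A root and its negative both in the cone would contradict the face property of the zero cone,
    -- the case `S = ∅`.
    have h0 : P.root i + P.root (P.reflectionPerm i i) ∈
        AddSubmonoid.closure (P.root '' (∅ : Set ι)) := by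
      simp
    have := (mem_closure_of_add_mem_closure b (Set.empty_subset _) h h' h0).1
    simp [P.ne_zero i] at this

/-- Induction along the positive roots spanned by a subset of the simple roots. -/
theorem spanned_induction_on_add (b : P.Base) {S : Set ι} (hS : S ⊆ b.support) {p : ι → Prop}
    (h₁ : ∀ i ∈ S, p i)
    (h₂ : ∀ i j k, P.root k = P.root i + P.root j → b.IsPos i →
      P.root i ∈ AddSubmonoid.closure (P.root '' S) → p i → j ∈ S → p k)
    {i : ι} (hi : b.IsPos i) (hiS : P.root i ∈ AddSubmonoid.closure (P.root '' S)) : p i := by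
  refine (hi.induction_on_add (p := fun k => b.IsPos k ∧
    (P.root k ∈ AddSubmonoid.closure (P.root '' S) → p k)) (fun j hj => ?_) ?_).2 hiS
  · exact ⟨RootPairing.Base.isPos_of_mem_support hj,
      fun h => h₁ j (mem_of_root_mem_closure b hS hj h)⟩
  · intro i j k hk ⟨hi, hpi⟩ hj
    have hj' := RootPairing.Base.isPos_of_mem_support hj
    refine ⟨hi.add hj' hk, fun h => ?_⟩
    rw [hk] at h
    obtain ⟨h3, h4⟩ := mem_closure_of_add_mem_closure b hS ((isPos_iff_mem_closure b).mp hi)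
      ((isPos_iff_mem_closure b).mp hj') h
    exact h₂ i j k hk hi h3 (hpi h3) (mem_of_root_mem_closure b hS hj h4)

variable [P.IsReduced]

/-- The reflection carries simple roots to simple roots of a new base. Such changes of base drive
the maximality argument for parabolic sets. -/
theorem exists_base_reflect (b : P.Base) (i : ι) :
    ∃ b' : P.Base, ∀ j, b'.IsPos j ↔ b.IsPos (P.reflectionPerm i j) := by
  have himage : P.root '' (P.reflectionPerm i '' b.support) =
      P.reflection i '' (P.root '' b.support) := by
    rw [Set.image_image, Set.image_image]
    exact Set.image_congr fun j _ => P.root_reflectionPerm i j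
  have hmem : ∀ x, x ∈ AddSubmonoid.closure (P.root '' (P.reflectionPerm i '' b.support)) ↔
      P.reflection i x ∈ AddSubmonoid.closure (P.root '' b.support) := by
    intro x
    have h : AddSubmonoid.closure (P.root '' (P.reflectionPerm i '' b.support)) =
        (AddSubmonoid.closure (P.root '' b.support)).map
          ((P.reflection i : M →ₗ[R] M) : M →+ M) := by
      rw [AddMonoidHom.map_mclosure, himage]; rfl
    rw [h, AddSubmonoid.mem_map]
    constructor
    · rintro ⟨y, hy, rfl⟩
      simpa using hy
    · intro hx
      exact ⟨_, hx, by simp⟩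
  have hli : LinearIndepOn R P.root (P.reflectionPerm i '' b.support) := by
    rw [linearIndepOn_iff_image P.root.injective.injOn, himage]
    have h1 := (linearIndepOn_iff_image P.root.injective.injOn).mp b.linearIndepOn_root
    exact h1.image (f := (P.reflection i : M →ₗ[R] M)) (by simp)
  refine ⟨RootPairing.Base.mk' P _ hli fun j => ?_, fun j => ?_⟩
  · rw [hmem, hmem, map_neg, ← P.root_reflectionPerm]
    exact b.root_mem_or_neg_mem _
  · rw [isPos_iff_mem_closure, isPos_iff_mem_closure]
    simp only [RootPairing.Base.mk', Set.Finite.coe_toFinset]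
    rw [hmem, P.root_reflectionPerm]

/-- A parabolic set of roots contains the positive roots of some base. -/
theorem exists_base_forall_isPos_mem {Q : Set ι}
    (hneg : ∀ i, i ∈ Q ∨ P.reflectionPerm i i ∈ Q)
    (hadd : ∀ i j k, P.root k = P.root i + P.root j → i ∈ Q → j ∈ Q → k ∈ Q) :
    ∃ b : P.Base, ∀ i, b.IsPos i → i ∈ Q := by
  have : Nonempty P.Base := P.nonempty_base
  -- Choose the base with a maximal set of positive roots in `Q`. If a simple root `i` were outside
  -- `Q`, reflecting in `i` would keep these roots positive, since a simple reflection permutes the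
  -- positive roots other than `i`, and would add `-i ∈ Q`.
  obtain ⟨A, ⟨b, rfl⟩, hmax⟩ := (Set.toFinite
    (Set.range fun b : P.Base => {i | b.IsPos i ∧ i ∈ Q})).exists_maximal (Set.range_nonempty _)
  have hsupp : ∀ i ∈ b.support, i ∈ Q := by
    intro i hi
    by_contra hiQ
    obtain ⟨b', hb'⟩ := exists_base_reflect b i
    have hposi := RootPairing.Base.isPos_of_mem_support hi
    have hsub : {j | b.IsPos j ∧ j ∈ Q} ⊆ {j | b'.IsPos j ∧ j ∈ Q} := by
      rintro j ⟨hj, hjQ⟩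
      exact ⟨(hb' j).mpr (hj.reflectionPerm hi (by rintro rfl; exact hiQ hjQ)), hjQ⟩
    have hmem : P.reflectionPerm i i ∈ {j | b'.IsPos j ∧ j ∈ Q} :=
      ⟨(hb' _).mpr (by simpa using hposi), (hneg i).resolve_left hiQ⟩
    have := hmax ⟨b', rfl⟩ hsub hmem
    exact (RootPairing.Base.IsPos.neg_iff_not b i).mp this.1 hposi
  refine ⟨b, fun i hi => hi.induction_on_add hsupp fun i j k hk hi hj => ?_⟩
  exact hadd i j k hk hi (hsupp j hj)

-- Identifies the Levi part of `Q`. If `k = i + j` with `j` simple and `-k ∈ Q`, then `-i = -k + j`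
-- and `-j = -k + i` lie in `Q`, so induction applies to `i` and `j` belongs to the generating set.
omit [P.IsReduced] in
theorem root_mem_closure_of_neg_mem {Q : Set ι}
    (hadd : ∀ i j k, P.root k = P.root i + P.root j → i ∈ Q → j ∈ Q → k ∈ Q)
    {b : P.Base} (hb : ∀ i, b.IsPos i → i ∈ Q) {i : ι} (hi : b.IsPos i)
    (hneg : P.reflectionPerm i i ∈ Q) :
    P.root i ∈ AddSubmonoid.closure
      (P.root '' {j | j ∈ b.support ∧ P.reflectionPerm j j ∈ Q}) := by
  refine (hi.induction_on_add (p := fun k => k ∈ Q ∧ (P.reflectionPerm k k ∈ Q → P.root k ∈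
    AddSubmonoid.closure (P.root '' {j | j ∈ b.support ∧ P.reflectionPerm j j ∈ Q})))
    (fun j hj => ?_) ?_).2 hneg
  · exact ⟨hb j (RootPairing.Base.isPos_of_mem_support hj),
      fun h => AddSubmonoid.subset_closure ⟨j, ⟨hj, h⟩, rfl⟩⟩
  · intro i j k hk ⟨hiQ, hi⟩ hj
    have hjQ := hb j (RootPairing.Base.isPos_of_mem_support hj)
    refine ⟨hadd i j k hk hiQ hjQ, fun hkQ => ?_⟩
    rw [hk]
    refine add_mem (hi (hadd _ j _ ?_ hkQ hjQ)) (AddSubmonoid.subset_closure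
      ⟨j, ⟨hj, hadd _ i _ ?_ hkQ hiQ⟩, rfl⟩)
    · simp only [P.root_reflectionPerm, P.reflection_apply_self]; rw [hk]; abel
    · simp only [P.root_reflectionPerm, P.reflection_apply_self]; rw [hk]; abel

end Parabolic

/-! ### The hyperbolic cotangent and its Riccati equation. -/

section Coth

/-- `p sinh z = cosh z` serves as a division-free form of `p = coth z`: it already excludes poles,
since `sinh` and `cosh` have no common zero. -/
theorem sinh_ne_zero_of_mul_eq_cosh {p z : ℂ} (h : p * Complex.sinh z = Complex.cosh z) :
    Complex.sinh z ≠ 0 := by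
  intro h0
  have h1 := Complex.cosh_sq_sub_sinh_sq z
  rw [← h, h0] at h1
  simp at h1

theorem eq_coth_of_mul_eq_cosh {p z : ℂ} (h : p * Complex.sinh z = Complex.cosh z) :
    p = coth z := by
  rw [coth, eq_div_iff (sinh_ne_zero_of_mul_eq_cosh h), h]

/-- In the division-free form the addition law passes to `z + w` without first knowing `sinh (z + w)
≠ 0`. -/
theorem mul_sinh_add_eq_cosh_add {p q s z w : ℂ} (hz : p * Complex.sinh z = Complex.cosh z)
    (hw : q * Complex.sinh w = Complex.cosh w) (h : s * (p + q) = 1 + p * q) :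
    s * Complex.sinh (z + w) = Complex.cosh (z + w) := by
  rw [Complex.sinh_add, Complex.cosh_add, ← hz, ← hw]
  linear_combination Complex.sinh z * Complex.sinh w * h

theorem coth_add_mul {z w : ℂ} (hz : Complex.sinh z ≠ 0) (hw : Complex.sinh w ≠ 0)
    (hzw : Complex.sinh (z + w) ≠ 0) :
    coth (z + w) * (coth z + coth w) = 1 + coth z * coth w := by
  rw [coth, coth, coth]
  field_simp
  rw [Complex.sinh_add, Complex.cosh_add]
  ring

variable {E : Type*} [NormedAddCommGroup E] [NormedSpace ℂ E]

theorem hasFDerivAt_coth (l : E →L[ℂ] ℂ) (c : ℂ) {x : E} (h : Complex.sinh (l x + c) ≠ 0) :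
    HasFDerivAt (fun y => coth (l y + c)) ((1 - coth (l x + c) ^ 2) • l) x := by
  have hc : HasDerivAt coth (1 - coth (l x + c) ^ 2) (l x + c) := by
    have := (Complex.hasDerivAt_cosh (l x + c)).div (Complex.hasDerivAt_sinh (l x + c)) h
    refine this.congr_deriv ?_
    simp only [coth]
    field_simp
  exact hc.comp_hasFDerivAt x (l.hasFDerivAt.add_const c)

theorem analyticAt_sinh_affine (l : E →L[ℂ] ℂ) (c : ℂ) (x : E) :
    AnalyticAt ℂ (fun y => Complex.sinh (l y + c)) x :=
  (Complex.differentiable_sinh.analyticAt (l x + c)).fun_comp_of_eq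
    ((l.analyticAt x).add analyticAt_const) rfl

theorem analyticAt_cosh_affine (l : E →L[ℂ] ℂ) (c : ℂ) (x : E) :
    AnalyticAt ℂ (fun y => Complex.cosh (l y + c)) x :=
  (Complex.differentiable_cosh.analyticAt (l x + c)).fun_comp_of_eq
    ((l.analyticAt x).add analyticAt_const) rfl

/-- If it vanished near `x`, so would its derivative `cosh · l`, and `sinh` and `cosh` would have a
common zero. -/
theorem not_eventually_sinh_affine_eq_zero {l : E →L[ℂ] ℂ} (hl : l ≠ 0) (c : ℂ) (x : E) :
    ¬ ∀ᶠ y in 𝓝 x, Complex.sinh (l y + c) = 0 := by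
  intro h
  have h1 : HasFDerivAt (fun y => Complex.sinh (l y + c)) (Complex.cosh (l x + c) • l) x :=
    (Complex.hasDerivAt_sinh _).comp_hasFDerivAt x (l.hasFDerivAt.add_const c)
  have h2 : HasFDerivAt (fun y => Complex.sinh (l y + c)) (0 : E →L[ℂ] ℂ) x :=
    (hasFDerivAt_const (0 : ℂ) x).congr_of_eventuallyEq h
  have h3 := (smul_eq_zero.mp (h1.unique h2)).resolve_right hl
  have h4 := Complex.cosh_sq_sub_sinh_sq (l x + c)
  rw [h3, h.self_of_nhds] at h4
  simp at h4

theorem isMeromorphicOn_coth_smul {F : Type*} [NormedAddCommGroup F] [NormedSpace ℂ F]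
    {l : E →L[ℂ] ℂ} (hl : l ≠ 0) (c : ℂ) (v : F) (U : Set E) :
    IsMeromorphicOn (fun y => coth (l y + c) • v) U := fun x _ =>
  ⟨fun y => Complex.sinh (l y + c), fun y => Complex.cosh (l y + c) • v,
    analyticAt_sinh_affine l c x, (analyticAt_cosh_affine l c x).smul analyticAt_const,
    not_eventually_sinh_affine_eq_zero hl c x, Eventually.of_forall fun y _ => by
      simp only [coth, div_eq_inv_mul, mul_smul]⟩

theorem genericallyOn_sinh_affine_ne_zero {l : E →L[ℂ] ℂ} (hl : l ≠ 0) (c : ℂ) (U : Set E) :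
    GenericallyOn U fun x => Complex.sinh (l x + c) ≠ 0 :=
  genericallyOn_ne_zero (fun x _ => analyticAt_sinh_affine l c x)
    fun x _ => not_eventually_sinh_affine_eq_zero hl c x

/-- Uniqueness for the linear equation `df = m f l` on a ball. -/
theorem eq_zero_of_hasFDerivAt_mul {f m : E → ℂ} {l : E →L[ℂ] ℂ} {x₀ : E} {ε : ℝ}
    (hf : ∀ x ∈ Metric.ball x₀ ε, HasFDerivAt f ((m x * f x) • l) x)
    (hm : ContinuousOn m (Metric.ball x₀ ε)) (h0 : f x₀ = 0) {x : E}
    (hx : x ∈ Metric.ball x₀ ε) : f x = 0 := by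
  -- Along the segment from `x₀` to `x` the equation becomes an ordinary linear one, and Grönwall's
  -- inequality with zero initial value and zero error gives `f = 0`.
  let γ : ℝ → E := fun t => x₀ + (t : ℂ) • (x - x₀)
  have hγc : Continuous γ := by fun_prop
  have hγ : ∀ t ∈ Set.Icc (0 : ℝ) 1, γ t ∈ Metric.ball x₀ ε := fun t ht => by
    rw [Metric.mem_ball, dist_eq_norm] at hx ⊢
    simp only [γ, add_sub_cancel_left, norm_smul, Complex.norm_real, Real.norm_eq_abs,
      abs_of_nonneg ht.1]
    exact (mul_le_of_le_one_left (norm_nonneg _) ht.2).trans_lt hx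
  have hd : ∀ t ∈ Set.Icc (0 : ℝ) 1,
      HasDerivAt (fun t => f (γ t)) (m (γ t) * f (γ t) * l (x - x₀)) t := fun t ht => by
    have h1 : HasDerivAt (fun s : ℂ => x₀ + s • (x - x₀)) (x - x₀) (t : ℂ) := by
      simpa using ((hasDerivAt_id (t : ℂ)).smul_const (x - x₀)).const_add x₀
    have h2 := (hf _ (hγ t ht)).comp_hasDerivAt (t : ℂ) h1
    exact h2.comp_ofReal
  obtain ⟨K, hK⟩ := isCompact_Icc.exists_bound_of_continuousOn
    (f := fun t => m (γ t) * l (x - x₀)) (s := Set.Icc (0 : ℝ) 1)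
    ((hm.comp hγc.continuousOn hγ).mul continuousOn_const)
  have := norm_le_gronwallBound_of_norm_deriv_right_le (f := fun t => f (γ t))
    (f' := fun t => m (γ t) * f (γ t) * l (x - x₀)) (δ := 0) (K := K) (ε := 0) (a := 0) (b := 1)
    (fun t ht => (hd t ht).continuousAt.continuousWithinAt)
    (fun t ht => (hd t ⟨ht.1, ht.2.le⟩).hasDerivWithinAt) (by simp [γ, h0])
    (fun t ht => by
      rw [add_zero, mul_right_comm, norm_mul]
      exact mul_le_mul_of_nonneg_right (hK t ⟨ht.1, ht.2.le⟩) (norm_nonneg _)) 1 (by simp)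
  simpa [γ, gronwallBound_ε0_δ0] using this

section Riccati

variable {φ : E → ℂ} {l : E →L[ℂ] ℂ} {x₀ : E} {ε : ℝ}
  (hφ : ∀ x ∈ Metric.ball x₀ ε, HasFDerivAt φ ((1 - φ x ^ 2) • l) x)
include hφ

theorem continuousOn_of_riccati : ContinuousOn φ (Metric.ball x₀ ε) := fun x hx =>
  (hφ x hx).continuousAt.continuousWithinAt

/-- `φ - 1` solves the linear equation with multiplier `-(φ + 1)`, because `1 - φ² = -(φ + 1)(φ -
1)`. -/
theorem riccati_eq_one (h0 : φ x₀ = 1) {x : E} (hx : x ∈ Metric.ball x₀ ε) : φ x = 1 := by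
  refine sub_eq_zero.mp (eq_zero_of_hasFDerivAt_mul (f := fun x => φ x - 1)
    (m := fun x => -(φ x + 1)) (l := l) (fun x hx => ?_)
    ((continuousOn_of_riccati hφ).add continuousOn_const).neg (by simp [h0]) hx)
  exact ((hφ x hx).sub_const 1).congr_fderiv (by congr 1; ring)

/-- `u = (φ + 1)e^{-l}` and `v = (φ - 1)e^{l}` solve the same linear equation, so they are
proportional. Both are nonzero at `x₀`, so their ratio is some `e^d`; since `(coth z + 1)/(coth z -
1) = e^{2z}`, the constant is `c = d/2`. -/
theorem riccati_mul_sinh_eq_cosh (h1 : φ x₀ ≠ 1) (h2 : φ x₀ ≠ -1) :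
    ∃ c, ∀ x ∈ Metric.ball x₀ ε, φ x * Complex.sinh (l x + c) = Complex.cosh (l x + c) := by
  let u : E → ℂ := fun x => (φ x + 1) * Complex.exp (-l x)
  let v : E → ℂ := fun x => (φ x - 1) * Complex.exp (l x)
  have hu : ∀ x ∈ Metric.ball x₀ ε, HasFDerivAt u ((-φ x * u x) • l) x := fun x hx => by
    have h := ((hφ x hx).add_const 1).mul (l.hasFDerivAt (x := x)).neg.cexp
    refine h.congr_fderiv ?_
    ext y
    simp [u]
    ring
  have hv : ∀ x ∈ Metric.ball x₀ ε, HasFDerivAt v ((-φ x * v x) • l) x := fun x hx => by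
    have h := ((hφ x hx).sub_const 1).mul (l.hasFDerivAt (x := x)).cexp
    refine h.congr_fderiv ?_
    ext y
    simp [v]
    ring
  have hw : ∀ x ∈ Metric.ball x₀ ε, v x₀ * u x - u x₀ * v x = 0 := fun x hx => by
    refine eq_zero_of_hasFDerivAt_mul (f := fun x => v x₀ * u x - u x₀ * v x)
      (m := fun x => -φ x) (l := l) (fun x hx => ?_) (continuousOn_of_riccati hφ).neg
      (by ring) hx
    refine (((hu x hx).const_mul (v x₀)).sub ((hv x hx).const_mul (u x₀))).congr_fderiv ?_
    ext y
    simp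
    ring
  have hu0 : u x₀ ≠ 0 := mul_ne_zero (fun h => h2 (eq_neg_of_add_eq_zero_left h))
    (Complex.exp_ne_zero _)
  have hv0 : v x₀ ≠ 0 := mul_ne_zero (sub_ne_zero.mpr h1) (Complex.exp_ne_zero _)
  obtain ⟨d, hd⟩ : ∃ d, Complex.exp d = u x₀ / v x₀ :=
    ⟨_, Complex.exp_log (div_ne_zero hu0 hv0)⟩
  refine ⟨d / 2, fun x hx => ?_⟩
  have h3 : u x = Complex.exp d * v x := by
    rw [hd]
    field_simp
    linear_combination hw x hx
  have h4 : Complex.exp d = Complex.exp (d / 2) * Complex.exp (d / 2) := by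
    rw [← Complex.exp_add, add_halves]
  have h5 : Complex.exp (-(d / 2)) * Complex.exp (d / 2) = 1 := by
    rw [← Complex.exp_add]; simp
  rw [Complex.sinh, Complex.cosh, neg_add, Complex.exp_add, Complex.exp_add]
  simp only [u, v, h4] at h3
  linear_combination (-Complex.exp (-(d / 2)) / 2) * h3 -
    (φ x - 1) * Complex.exp (l x) * Complex.exp (d / 2) / 2 * h5

end Riccati

end Coth

/-! ### Two-forms as tensors, and the components of the standard r-matrix. -/

section Standard

open LieAlgebra LieModule LieAlgebra.IsKilling

variable {𝔤 : Type*} [LieRing 𝔤] [LieAlgebra ℂ 𝔤] [FiniteDimensional ℂ 𝔤]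
  [LieAlgebra.IsKilling ℂ 𝔤] {H : LieSubalgebra ℂ 𝔤} [H.IsCartanSubalgebra]

/-- The functional `⟨α, ·⟩` on `𝔥*`. -/
def rootFunctional (a : Dual ℂ H) : Dual ℂ H →L[ℂ] ℂ :=
  LinearMap.toContinuousLinearMap (cartanRestrict H ((cartanEquivDual H).symm a : 𝔤) ∘ₗ
    ((cartanEquivDual H).symm : Dual ℂ H →ₗ[ℂ] H))

theorem dualPairing_eq_rootFunctional (a v : Dual ℂ H) : dualPairing a v = rootFunctional a v := rfl

theorem rootFunctional_cartanEquivDual (a : Dual ℂ H) (h : H) :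
    rootFunctional a (cartanEquivDual H h) = a h := by
  have h1 : rootFunctional a (cartanEquivDual H h) =
      cartanRestrict H ((cartanEquivDual H).symm a : 𝔤) h := by
    simp [rootFunctional]
  rw [h1, cartanRestrict_coe, LinearEquiv.apply_symm_apply]

theorem rootFunctional_add (a a' v : Dual ℂ H) :
    rootFunctional (a + a') v = rootFunctional a v + rootFunctional a' v := by
  obtain ⟨h, rfl⟩ := (cartanEquivDual H).surjective v
  simp only [rootFunctional_cartanEquivDual, LinearMap.add_apply]

theorem rootFunctional_neg (a : Dual ℂ H) : rootFunctional (-a) = -rootFunctional a := by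
  ext v
  obtain ⟨h, rfl⟩ := (cartanEquivDual H).surjective v
  simp only [rootFunctional_cartanEquivDual, LinearMap.neg_apply, neg_apply]

theorem rootFunctional_ne_zero {a : Dual ℂ H} (ha : a ≠ 0) : rootFunctional a ≠ 0 := by
  intro h
  refine ha (LinearMap.ext fun k => ?_)
  rw [← rootFunctional_cartanEquivDual, h]
  rfl

theorem continuous_killingPair_cartan (t : 𝔤 ⊗[ℂ] 𝔤) (i j : Fin 2) :
    Continuous fun v : Fin 2 → Dual ℂ H =>
      killingPair ((cartanEquivDual H).symm (v i) : 𝔤) ((cartanEquivDual H).symm (v j) : 𝔤) t := by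
  have h : ∀ (a : 𝔤) (i : Fin 2), Continuous fun v : Fin 2 → Dual ℂ H =>
      killingForm ℂ 𝔤 ((cartanEquivDual H).symm (v i) : 𝔤) a := fun a i => by
    have h1 : Continuous fun u : Dual ℂ H => cartanRestrict H a ((cartanEquivDual H).symm u) :=
      (cartanRestrict H a ∘ₗ
        ((cartanEquivDual H).symm : Dual ℂ H →ₗ[ℂ] H)).continuous_of_finiteDimensional
    refine (h1.comp (continuous_apply i)).congr fun v => ?_
    rw [killingForm_swap]
    rfl
  induction t with
  | zero => simpa using continuous_const
  | tmul a b => simp only [killingPair_tmul]; exact (h a i).mul (h b j)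
  | add s t hs ht => simp only [map_add]; exact hs.add ht

/-- The two-form on `𝔥*` given by the component of a tensor in `𝔥 ⊗ 𝔥`. -/
def tensorToForm : 𝔤 ⊗[ℂ] 𝔤 →ₗ[ℂ] Dual ℂ H [⋀^Fin 2]→L[ℂ] ℂ where
  toFun t :=
    -- Antisymmetrising makes the form alternating for every tensor, so the map is linear on all of
    -- `𝔤 ⊗ 𝔤`; the factor `1/2` makes it the plain pairing on skew tensors.
    { toFun := fun v => (1 / 2) *
        (killingPair ((cartanEquivDual H).symm (v 0) : 𝔤) ((cartanEquivDual H).symm (v 1) : 𝔤) t -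
          killingPair ((cartanEquivDual H).symm (v 1) : 𝔤) ((cartanEquivDual H).symm (v 0) : 𝔤) t)
      map_update_add' := fun m i x y => by
        fin_cases i <;> simp [killingPair_add_left, killingPair_add_right] <;> ring
      map_update_smul' := fun m i c x => by
        fin_cases i <;> simp [killingPair_smul_left, killingPair_smul_right] <;> ring
      map_eq_zero_of_eq' := fun v i j hv hij => by
        have h : v 0 = v 1 := by
          fin_cases i <;> fin_cases j <;> simp_all
        simp [h]
      cont := continuous_const.mul
        ((continuous_killingPair_cartan t 0 1).sub (continuous_killingPair_cartan t 1 0)) }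
  map_add' s t := by
    ext v
    change (1 / 2 : ℂ) * _ = (1 / 2 : ℂ) * _ + (1 / 2 : ℂ) * _
    simp only [map_add]
    ring
  map_smul' c t := by
    ext v
    change (1 / 2 : ℂ) * _ = c * ((1 / 2 : ℂ) * _)
    simp only [map_smul, smul_eq_mul]
    ring

theorem tensorToForm_apply {t : 𝔤 ⊗[ℂ] 𝔤} (ht : t ∈ wedgeTwo 𝔤) (h h' : H) :
    tensorToForm t ![cartanEquivDual H h, cartanEquivDual H h'] =
      killingPair (h : 𝔤) (h' : 𝔤) t := by
  change (1 / 2) * (killingPair ((cartanEquivDual H).symm (cartanEquivDual H h) : 𝔤)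
    ((cartanEquivDual H).symm (cartanEquivDual H h') : 𝔤) t -
      killingPair ((cartanEquivDual H).symm (cartanEquivDual H h') : 𝔤)
        ((cartanEquivDual H).symm (cartanEquivDual H h) : 𝔤) t) = _
  rw [LinearEquiv.symm_apply_apply, LinearEquiv.symm_apply_apply,
    killingPair_swap ht (h' : 𝔤) (h : 𝔤)]
  ring

variable {E : Weight ℂ H 𝔤 → 𝔤}
  (hE : ∀ a : Weight ℂ H 𝔤, a.IsNonZero → E a ∈ rootSpace H a)
  (hE_norm : ∀ a : Weight ℂ H 𝔤, a.IsNonZero → killingForm ℂ 𝔤 (E a) (E (-a)) = 1)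

theorem wedge_mem_wedgeTwo (x y : 𝔤) : wedge x y ∈ wedgeTwo 𝔤 := by
  rw [mem_wedgeTwo]; simp [wedge]

include hE in
theorem wedge_mem_zeroWeightSkew {a : Weight ℂ H 𝔤} (ha : a.IsNonZero) :
    wedge (E a) (E (-a)) ∈ zeroWeightSkew H := by
  refine ⟨wedge_mem_wedgeTwo _ _, fun h => ?_⟩
  have h1 : ⁅(h : 𝔤), E a⁆ = a h • E a := lie_eq_smul_of_mem_rootSpace (hE a ha) h
  have h2 : ⁅(h : 𝔤), E (-a)⁆ = -a h • E (-a) :=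
    lie_eq_smul_of_mem_rootSpace (hE (-a) (by simpa using ha)) h
  rw [wedge, lie_sub, TensorProduct.LieModule.lie_tmul_right,
    TensorProduct.LieModule.lie_tmul_right, h1, h2]
  simp only [neg_smul, tmul_neg, neg_tmul, ← smul_tmul', tmul_smul]
  abel

theorem formToTensor_mem_zeroWeightSkew (w : Dual ℂ H [⋀^Fin 2]→L[ℂ] ℂ) :
    formToTensor w ∈ zeroWeightSkew H := by
  refine ⟨?_, fun h => ?_⟩
  · rw [mem_wedgeTwo, formToTensor, ← Finset.sum_neg_distrib, Finset.sum_comm]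
    simp only [map_sum, map_smul, TensorProduct.comm_tmul]
    refine Finset.sum_congr rfl fun i _ => ?_
    rw [← Finset.sum_neg_distrib]
    refine Finset.sum_congr rfl fun j _ => ?_
    have := w.toAlternatingMap.map_swap ![(finBasis ℂ H).coord i, (finBasis ℂ H).coord j]
      (i := 0) (j := 1) (by simp)
    have h2 : ![(finBasis ℂ H).coord i, (finBasis ℂ H).coord j] ∘ Equiv.swap 0 1 =
        ![(finBasis ℂ H).coord j, (finBasis ℂ H).coord i] := by
      ext k; fin_cases k <;> simp
    rw [h2] at this
    rw [← neg_smul]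
    congr 1
  · simp only [formToTensor, lie_sum, lie_smul, TensorProduct.LieModule.lie_tmul_right,
      lie_coe_coe, zero_tmul, tmul_zero, add_zero, smul_zero, Finset.sum_const_zero]

theorem cartanEquivDual_eq_sum (h : H) : cartanEquivDual H h =
    ∑ i, killingForm ℂ 𝔤 h (finBasis ℂ H i) • (finBasis ℂ H).coord i := by
  refine (finBasis ℂ H).ext fun j => ?_
  rw [← cartanRestrict_coe]
  simp [Finsupp.single_apply]

theorem killingPair_formToTensor (w : Dual ℂ H [⋀^Fin 2]→L[ℂ] ℂ) (h h' : H) :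
    killingPair (h : 𝔤) (h' : 𝔤) (formToTensor w) =
      w ![cartanEquivDual H h, cartanEquivDual H h'] := by
  have key : ∀ u v : Dual ℂ H, w ![u, v] = (AlternatingMap.toMultilinearMap
      w.toAlternatingMap).curryLeft u ![v] := fun u v => rfl
  have h1 : ∀ v : Dual ℂ H, w ![cartanEquivDual H h, v] =
      ∑ i, killingForm ℂ 𝔤 h (finBasis ℂ H i) * w ![(finBasis ℂ H).coord i, v] := fun v => by
    simp only [key]
    rw [cartanEquivDual_eq_sum h, map_sum]
    simp
  have key' : ∀ u v : Dual ℂ H, w ![u, v] = (AlternatingMap.toMultilinearMap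
      w.toAlternatingMap).toLinearMap ![u, 0] 1 v := fun u v => by
    simp only [MultilinearMap.toLinearMap_apply]
    change w _ = w _
    congr 1
    ext k
    fin_cases k <;> simp
  have h2 : ∀ u : Dual ℂ H, w ![u, cartanEquivDual H h'] =
      ∑ i, killingForm ℂ 𝔤 h' (finBasis ℂ H i) * w ![u, (finBasis ℂ H).coord i] := fun u => by
    simp only [key']
    rw [cartanEquivDual_eq_sum h', map_sum]
    simp
  rw [h1]
  simp only [h2, formToTensor, map_sum, map_smul, killingPair_tmul, smul_eq_mul, Finset.mul_sum]
  refine Finset.sum_congr rfl fun i _ => Finset.sum_congr rfl fun j _ => ?_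
  ring

include hE in
theorem rootCoeff_formToTensor (w : Dual ℂ H [⋀^Fin 2]→L[ℂ] ℂ) {a : Weight ℂ H 𝔤}
    (ha : a.IsNonZero) : rootCoeff E a (formToTensor w) = 0 := by
  simp [rootCoeff, formToTensor, killingForm_eq_zero_of_mem_rootSpace ha (hE a ha)]

include hE in
theorem killingPair_coe_coe_wedge (h h' : H) {a : Weight ℂ H 𝔤} (ha : a.IsNonZero) :
    killingPair (h : 𝔤) (h' : 𝔤) (wedge (E a) (E (-a))) = 0 := by
  have h0 : ∀ k : H, killingForm ℂ 𝔤 k (E a) = 0 := fun k => by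
    rw [killingForm_swap, killingForm_eq_zero_of_mem_rootSpace ha (hE a ha)]
  simp [wedge, h0]

include hE hE_norm in
theorem rootCoeff_wedge_self {a : Weight ℂ H 𝔤} (ha : a.IsNonZero) :
    rootCoeff E a (wedge (E a) (E (-a))) = 1 := by
  have h0 : killingForm ℂ 𝔤 (E a) (E a) = 0 := by
    refine killingForm_apply_eq_zero_of_mem_rootSpace_of_add_ne_zero ℂ 𝔤 H (hE a ha) (hE a ha) ?_
    rw [← two_smul ℕ]
    exact smul_ne_zero two_ne_zero ha
  rw [rootCoeff, wedge, map_sub, killingPair_tmul, killingPair_tmul, h0, hE_norm a ha,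
    killingForm_swap, hE_norm a ha]
  simp

include hE in
theorem rootCoeff_wedge_of_ne {a b : Weight ℂ H 𝔤} (ha : a.IsNonZero) (hb : b.IsNonZero)
    (hab : b ≠ a) (hab' : b ≠ -a) : rootCoeff E b (wedge (E a) (E (-a))) = 0 := by
  have h0 : killingForm ℂ 𝔤 (E b) (E a) = 0 := by
    refine killingForm_apply_eq_zero_of_mem_rootSpace_of_add_ne_zero ℂ 𝔤 H (hE b hb) (hE a ha) ?_
    intro h
    exact hab' (by rw [eq_neg_of_coe_add_eq_zero h, neg_neg])
  have h1 : killingForm ℂ 𝔤 (E b) (E (-a)) = 0 := by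
    refine killingForm_apply_eq_zero_of_mem_rootSpace_of_add_ne_zero ℂ 𝔤 H (hE b hb)
      (hE (-a) (by simpa using ha)) ?_
    intro h
    exact hab (by rw [← neg_neg b, ← eq_neg_of_coe_add_eq_zero h, neg_neg])
  rw [rootCoeff, wedge, map_sub, killingPair_tmul, killingPair_tmul, h0, h1]
  simp

variable (b : (rootSystem H).Base) (S : Set H.root) (lam₀ : H)

open Classical in
/-- The coefficient of `E_α ∧ E_{-α}` in the standard r-matrix. -/
def stdCoeff (lam : Dual ℂ H) (a : H.root) : ℂ :=
  if a ∈ spannedRoots b S then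
    coth (rootFunctional ((rootSystem H).root a) lam + (rootSystem H).root a lam₀) else 1

open Classical in
theorem standardRMatrix_eq_sum (lam : Dual ℂ H) : standardRMatrix E b S lam₀ lam =
    ∑ a : H.root with a ∈ positiveRoots b, stdCoeff b S lam₀ lam a • wedge (E a) (E (-a)) := by
  simp only [standardRMatrix, Finset.sum_filter]
  rw [← Finset.sum_add_distrib]
  refine Finset.sum_congr rfl fun a _ => ?_
  rw [dualPairing_eq_rootFunctional, map_add, rootFunctional_cartanEquivDual, stdCoeff]
  by_cases h : a ∈ spannedRoots b S
  · have h' : a ∈ positiveRoots b := h.1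
    simp [h, h']
  · by_cases h' : a ∈ positiveRoots b <;> simp [h, h']

include hE in
theorem standardRMatrix_mem_zeroWeightSkew (lam : Dual ℂ H) :
    standardRMatrix E b S lam₀ lam ∈ zeroWeightSkew H := by
  rw [standardRMatrix_eq_sum]
  exact sum_mem fun a _ => Submodule.smul_mem _ _
    (wedge_mem_zeroWeightSkew hE (H.isNonZero_coe_root a))

include hE in
theorem killingPair_coe_coe_standardRMatrix (lam : Dual ℂ H) (h h' : H) :
    killingPair (h : 𝔤) (h' : 𝔤) (standardRMatrix E b S lam₀ lam) = 0 := by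
  rw [standardRMatrix_eq_sum, map_sum]
  refine Finset.sum_eq_zero fun a _ => ?_
  rw [map_smul, killingPair_coe_coe_wedge hE _ _ (H.isNonZero_coe_root a), smul_zero]

theorem coe_reflectionPerm_self (a : H.root) :
    (((rootSystem H).reflectionPerm a a : H.root) : Weight ℂ H 𝔤) = -(a : Weight ℂ H 𝔤) := by
  have h := (rootSystem H).root_reflectionPerm a a
  rw [(rootSystem H).reflection_apply_self] at h
  ext x
  exact LinearMap.congr_fun h x

include hE hE_norm in
theorem rootCoeff_standardRMatrix (lam : Dual ℂ H) {a : H.root} (ha : b.IsPos a) :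
    rootCoeff E a (standardRMatrix E b S lam₀ lam) = stdCoeff b S lam₀ lam a := by
  classical
  rw [standardRMatrix_eq_sum, map_sum, Finset.sum_eq_single a]
  · rw [map_smul, rootCoeff_wedge_self hE hE_norm (H.isNonZero_coe_root a), smul_eq_mul, mul_one]
  · intro c hc hca
    have hcpos : b.IsPos c := (Finset.mem_filter.mp hc).2
    rw [map_smul, rootCoeff_wedge_of_ne hE (H.isNonZero_coe_root c) (H.isNonZero_coe_root a),
      smul_zero]
    · exact fun h => hca (Subtype.ext h.symm)
    · intro h
      rw [← coe_reflectionPerm_self] at h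
      rw [Subtype.ext h] at ha
      exact (RootPairing.Base.IsPos.neg_iff_not b c).mp ha hcpos
  · intro h
    exact absurd (Finset.mem_filter.mpr ⟨Finset.mem_univ a, ha⟩) h

include hE hE_norm in
/-- A skew-symmetric tensor of weight zero is determined by its components. -/
theorem eq_of_rootCoeff_eq {s t : 𝔤 ⊗[ℂ] 𝔤} (hs : s ∈ zeroWeightSkew H) (ht : t ∈ zeroWeightSkew H)
    (h1 : ∀ a : H.root, b.IsPos a → rootCoeff E a s = rootCoeff E a t)
    (h2 : ∀ h h' : H, killingPair (h : 𝔤) (h' : 𝔤) s = killingPair (h : 𝔤) (h' : 𝔤) t) : s = t := by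
  rw [← sub_eq_zero]
  have hst := sub_mem hs ht
  have h0 : ∀ a : Weight ℂ H 𝔤, a.IsNonZero → rootCoeff E a (s - t) = 0 := fun a ha => by
    let a' : H.root := ⟨a, by simpa using ha⟩
    rcases RootPairing.Base.IsPos.or_neg b a' with h | h
    · rw [map_sub, h1 a' h, sub_self]
    · have h3 := h1 _ h
      change rootCoeff E ((rootSystem H).reflectionPerm a' a' : H.root) s =
        rootCoeff E ((rootSystem H).reflectionPerm a' a' : H.root) t at h3
      rw [coe_reflectionPerm_self, rootCoeff_neg hs.1, rootCoeff_neg ht.1, neg_inj] at h3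
      rw [map_sub, h3, sub_self]
  refine eq_zero_of_killingPair_generators hE hE_norm ?_
  rintro x (hx | ⟨a, ha, rfl⟩) y (hy | ⟨c, hc, rfl⟩)
  · rw [map_sub, h2 ⟨x, hx⟩ ⟨y, hy⟩, sub_self]
  · exact killingPair_coe_rootVector hE hst hc ⟨x, hx⟩
  · exact killingPair_rootVector_coe hE hst ha ⟨y, hy⟩
  · by_cases hac : (a : H → ℂ) + c = 0
    · have h3 := h0 c hc
      rwa [rootCoeff, ← eq_neg_of_coe_add_eq_zero (by rwa [add_comm])] at h3
    · exact killingPair_eq_zero_of_add_ne_zero hst hac (hE a ha) (hE c hc)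

end Standard

/-! ### The equation at a point of differentiability. -/

section Pointwise

open LieAlgebra LieModule LieAlgebra.IsKilling

variable {𝔤 : Type*} [LieRing 𝔤] [LieAlgebra ℂ 𝔤] [FiniteDimensional ℂ 𝔤]
  [LieAlgebra.IsKilling ℂ 𝔤] {H : LieSubalgebra ℂ 𝔤} [H.IsCartanSubalgebra]

theorem hasFDerivAt_linearMap_comp {r : Dual ℂ H → 𝔤 ⊗[ℂ] 𝔤} {x : Dual ℂ H}
    (hr : DifferentiableAt ℂ r x) (f : 𝔤 ⊗[ℂ] 𝔤 →ₗ[ℂ] ℂ) :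
    HasFDerivAt (fun y => f (r y))
      ((LinearMap.toContinuousLinearMap f).comp (fderiv ℂ r x)) x :=
  (LinearMap.toContinuousLinearMap f).hasFDerivAt.comp x hr.hasFDerivAt

/-- A functional that annihilates `Z` vanishes along `r` near `x`, so it kills the derivative; such
functionals cut out `Z`. -/
theorem fderiv_mem_of_eventually_mem {r : Dual ℂ H → 𝔤 ⊗[ℂ] 𝔤} {x : Dual ℂ H}
    (hr : DifferentiableAt ℂ r x) {Z : Submodule ℂ (𝔤 ⊗[ℂ] 𝔤)} (hZ : ∀ᶠ y in 𝓝 x, r y ∈ Z)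
    (v : Dual ℂ H) : fderiv ℂ r x v ∈ Z := by
  rw [← Subspace.forall_mem_dualAnnihilator_apply_eq_zero_iff]
  intro f hf
  have h1 := hasFDerivAt_linearMap_comp hr f
  have h2 : HasFDerivAt (fun y => f (r y)) (0 : Dual ℂ H →L[ℂ] ℂ) x :=
    (hasFDerivAt_const (0 : ℂ) x).congr_of_eventuallyEq
      (hZ.mono fun y hy => (Submodule.mem_dualAnnihilator f).mp hf _ hy)
  exact DFunLike.congr_fun (h1.unique h2) v

theorem hasFDerivAt_form_apply {w : Dual ℂ H → Dual ℂ H [⋀^Fin 2]→L[ℂ] ℂ} {x : Dual ℂ H}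
    (hw : DifferentiableAt ℂ w x) (m : Fin 2 → Dual ℂ H) :
    HasFDerivAt (fun y => w y m)
      ((ContinuousAlternatingMap.apply ℂ (Dual ℂ H) ℂ m).comp (fderiv ℂ w x)) x :=
  hw.hasFDerivAt.continuousAlternatingMap_apply_const m

theorem extDeriv_eq_zero_iff {w : Dual ℂ H → Dual ℂ H [⋀^Fin 2]→L[ℂ] ℂ} {x : Dual ℂ H}
    (hw : DifferentiableAt ℂ w x) : extDeriv w x = 0 ↔ ∀ h h' h'' : H,
      fderiv ℂ w x (cartanEquivDual H h) ![cartanEquivDual H h', cartanEquivDual H h''] +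
      fderiv ℂ w x (cartanEquivDual H h') ![cartanEquivDual H h'', cartanEquivDual H h] +
      fderiv ℂ w x (cartanEquivDual H h'') ![cartanEquivDual H h, cartanEquivDual H h'] = 0 := by
  have hswap : ∀ (f : Dual ℂ H [⋀^Fin 2]→L[ℂ] ℂ) (u v : Dual ℂ H), f ![u, v] = -f ![v, u] := by
    intro f u v
    have := f.toAlternatingMap.map_swap ![v, u] (i := 0) (j := 1) (by simp)
    have h2 : ![v, u] ∘ Equiv.swap 0 1 = ![u, v] := by
      ext k; fin_cases k <;> simp
    rw [h2] at this
    exact this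
  have key : ∀ v : Fin 3 → Dual ℂ H, extDeriv w x v = fderiv ℂ w x (v 0) ![v 1, v 2] +
      fderiv ℂ w x (v 1) ![v 2, v 0] + fderiv ℂ w x (v 2) ![v 0, v 1] := fun v => by
    have h0 : Fin.removeNth 0 v = ![v 1, v 2] := by ext k; fin_cases k <;> rfl
    have h1 : Fin.removeNth 1 v = ![v 0, v 2] := by ext k; fin_cases k <;> rfl
    have h2 : Fin.removeNth 2 v = ![v 0, v 1] := by ext k; fin_cases k <;> rfl
    rw [extDeriv_apply hw]
    simp only [(hasFDerivAt_form_apply hw _).fderiv]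
    rw [Fin.sum_univ_three, h0, h1, h2]
    change (-1 : ℤ) ^ 0 • fderiv ℂ w x (v 0) ![v 1, v 2] +
      (-1 : ℤ) ^ 1 • fderiv ℂ w x (v 1) ![v 0, v 2] +
      (-1 : ℤ) ^ 2 • fderiv ℂ w x (v 2) ![v 0, v 1] = _
    -- Swapping the arguments of the middle term absorbs its sign and produces the cyclic sum.
    rw [hswap _ (v 0) (v 2)]
    simp
  constructor
  · intro h0 h h' h''
    have := key ![cartanEquivDual H h, cartanEquivDual H h', cartanEquivDual H h'']
    rw [h0] at this
    exact this.symm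
  · intro h
    ext v
    obtain ⟨h0, h0'⟩ := (cartanEquivDual H).surjective (v 0)
    obtain ⟨h1, h1'⟩ := (cartanEquivDual H).surjective (v 1)
    obtain ⟨h2, h2'⟩ := (cartanEquivDual H).surjective (v 2)
    rw [key, ← h0', ← h1', ← h2', h]
    rfl

variable {E : Weight ℂ H 𝔤 → 𝔤}
  (hE : ∀ a : Weight ℂ H 𝔤, a.IsNonZero → E a ∈ rootSpace H a)
  (hE_norm : ∀ a : Weight ℂ H 𝔤, a.IsNonZero → killingForm ℂ 𝔤 (E a) (E (-a)) = 1)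

include hE hE_norm in
/-- The classical dynamical Yang-Baxter equation at a point, in components. -/
theorem cdybe_at_iff {r : Dual ℂ H → 𝔤 ⊗[ℂ] 𝔤} {w : Dual ℂ H → Dual ℂ H [⋀^Fin 2]→L[ℂ] ℂ}
    {x : Dual ℂ H} (hr : DifferentiableAt ℂ r x) (hw : DifferentiableAt ℂ w x)
    (hZ : ∀ᶠ y in 𝓝 x, r y ∈ zeroWeightSkew H)
    (hrw : ∀ᶠ y in 𝓝 x, ∀ h h' : H,
      killingPair (h : 𝔤) (h' : 𝔤) (r y) = w y ![cartanEquivDual H h, cartanEquivDual H h']) :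
    altD r x + (1 / 2 : ℂ) • schouten 𝔤 (r x) (r x) =
      ((2 : ℂ) ^ 2 / 4) • comm₁₂₂₃ 𝔤 (casimir 𝔤) (casimir 𝔤) ↔
    (∀ a : Weight ℂ H 𝔤, a.IsNonZero → HasFDerivAt (fun y => rootCoeff E a (r y))
      ((1 - rootCoeff E a (r x) ^ 2) • rootFunctional (Weight.toLinear ℂ H 𝔤 a)) x) ∧
    (∀ a b c : Weight ℂ H 𝔤, a.IsNonZero → b.IsNonZero → c.IsNonZero →
      (a : H → ℂ) + b + c = 0 → rootCoeff E a (r x) * rootCoeff E b (r x) +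
        rootCoeff E b (r x) * rootCoeff E c (r x) + rootCoeff E c (r x) * rootCoeff E a (r x) = -1) ∧
    extDeriv w x = 0 := by
  have h := cdybe_iff hE hE_norm (D := (fderiv ℂ r x : Dual ℂ H →ₗ[ℂ] 𝔤 ⊗[ℂ] 𝔤))
    (fderiv_mem_of_eventually_mem hr hZ) hZ.self_of_nhds
  refine h.trans (and_congr ?_ (and_congr Iff.rfl ?_))
  · refine forall₂_congr fun a ha => ?_
    have h1 := hasFDerivAt_linearMap_comp hr (rootCoeff E a)
    constructor
    · intro h2
      refine h1.congr_fderiv (ContinuousLinearMap.ext fun v => ?_)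
      obtain ⟨k, rfl⟩ := (cartanEquivDual H).surjective v
      exact (h2 k).trans (by
        rw [smul_apply, rootFunctional_cartanEquivDual]; rfl)
    · intro h2 k
      have h3 := DFunLike.congr_fun (h1.unique h2) (cartanEquivDual H k)
      rw [smul_apply, rootFunctional_cartanEquivDual] at h3
      exact h3
  · rw [extDeriv_eq_zero_iff hw]
    have key : ∀ v : Dual ℂ H, ∀ h h' : H, killingPair (h : 𝔤) (h' : 𝔤) (fderiv ℂ r x v) =
        fderiv ℂ w x v ![cartanEquivDual H h, cartanEquivDual H h'] := fun v h h' => by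
      have h1 := hasFDerivAt_linearMap_comp hr (killingPair (h : 𝔤) (h' : 𝔤))
      have h2 := hasFDerivAt_form_apply hw ![cartanEquivDual H h, cartanEquivDual H h']
      have h3 := h2.congr_of_eventuallyEq (hrw.mono fun y hy => hy h h')
      exact DFunLike.congr_fun (h1.unique h3) v
    simp only [← key]
    rfl

end Pointwise

/-! ### Solving for the root coefficients. -/

section Coefficients

open LieAlgebra LieModule LieAlgebra.IsKilling

variable {𝔤 : Type*} [LieRing 𝔤] [LieAlgebra ℂ 𝔤] [FiniteDimensional ℂ 𝔤]
  [LieAlgebra.IsKilling ℂ 𝔤] {H : LieSubalgebra ℂ 𝔤} [H.IsCartanSubalgebra]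

/-- Simple roots form a basis of `𝔥*`, so a functional on `𝔥*` takes the prescribed values, and by
reflexivity it is evaluation at some `h`. This produces `λ₀` from the integration constants. -/
theorem exists_forall_root_apply_eq (b : (rootSystem H).Base) (c : H.root → ℂ) :
    ∃ h : H, ∀ i ∈ b.support, (rootSystem H).root i h = c i := by
  let g : Dual ℂ H →ₗ[ℂ] ℂ := b.toWeightBasis.constr ℂ fun i => c i
  refine ⟨(evalEquiv ℂ H).symm g, fun i hi => ?_⟩
  rw [apply_evalEquiv_symm_apply]
  have := b.toWeightBasis.constr_basis ℂ (fun i => c i) ⟨i, hi⟩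
  rwa [b.toWeightBasis_apply] at this

/-- An odd function on the roots which satisfies the addition law of the hyperbolic cotangent on
positive roots satisfies it on all roots. -/
theorem add_mul_eq_neg_one_of_isPos {φ : Weight ℂ H 𝔤 → ℂ} (hneg : ∀ a, φ (-a) = -φ a)
    (b : (rootSystem H).Base)
    (hadd : ∀ i j k : H.root, (rootSystem H).root k = (rootSystem H).root i + (rootSystem H).root j →
      b.IsPos i → b.IsPos j → φ k * (φ i + φ j) = 1 + φ i * φ j)
    {a₁ a₂ a₃ : Weight ℂ H 𝔤} (h₁ : a₁.IsNonZero) (h₂ : a₂.IsNonZero) (h₃ : a₃.IsNonZero)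
    (h : (a₁ : H → ℂ) + a₂ + a₃ = 0) : φ a₁ * φ a₂ + φ a₂ * φ a₃ + φ a₃ * φ a₁ = -1 := by
  have pos : ∀ a₁ a₂ a₃ : H.root, ((a₁ : Weight ℂ H 𝔤) : H → ℂ) + (a₂ : Weight ℂ H 𝔤) +
      (a₃ : Weight ℂ H 𝔤) = 0 → b.IsPos a₁ → b.IsPos a₂ →
        φ a₁ * φ a₂ + φ a₂ * φ a₃ + φ a₃ * φ a₁ = -1 := by
    intro a₁ a₂ a₃ h h₁ h₂
    have h₃ := hadd a₁ a₂ ((rootSystem H).reflectionPerm a₃ a₃) (by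
      rw [RootPairing.root_reflectionPerm, RootPairing.reflection_apply_self]
      ext x
      exact (eq_neg_of_add_eq_zero_left (congrFun h x)).symm) h₁ h₂
    rw [coe_reflectionPerm_self, hneg] at h₃
    linear_combination -h₃
  -- The relation is quadratic and `φ` is odd, so negating all three roots reduces two negative
  -- roots to two positive ones.
  have same : ∀ a₁ a₂ a₃ : H.root, ((a₁ : Weight ℂ H 𝔤) : H → ℂ) + (a₂ : Weight ℂ H 𝔤) +
      (a₃ : Weight ℂ H 𝔤) = 0 → (b.IsPos a₁ ↔ b.IsPos a₂) →
        φ a₁ * φ a₂ + φ a₂ * φ a₃ + φ a₃ * φ a₁ = -1 := by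
    intro a₁ a₂ a₃ h h₁₂
    by_cases h₁ : b.IsPos a₁
    · exact pos a₁ a₂ a₃ h h₁ (h₁₂.mp h₁)
    · have h₂ : ¬ b.IsPos a₂ := mt h₁₂.mpr h₁
      have := pos ((rootSystem H).reflectionPerm a₁ a₁) ((rootSystem H).reflectionPerm a₂ a₂)
        ((rootSystem H).reflectionPerm a₃ a₃) (by
          simp only [coe_reflectionPerm_self, Weight.coe_neg]
          rw [← neg_add, ← neg_add, h, neg_zero])
        ((RootPairing.Base.IsPos.or_neg b a₁).resolve_left h₁)
        ((RootPairing.Base.IsPos.or_neg b a₂).resolve_left h₂)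
      simp only [coe_reflectionPerm_self, hneg] at this
      linear_combination this
  let i₁ : H.root := ⟨a₁, by simpa using h₁⟩
  let i₂ : H.root := ⟨a₂, by simpa using h₂⟩
  let i₃ : H.root := ⟨a₃, by simpa using h₃⟩
  -- Among three roots two have the same sign, and the relation is invariant under rotation.
  by_cases h₁₂ : b.IsPos i₁ ↔ b.IsPos i₂
  · exact same i₁ i₂ i₃ h h₁₂
  by_cases h₂₃ : b.IsPos i₂ ↔ b.IsPos i₃
  · have := same i₂ i₃ i₁ (by rw [← h]; change (a₂ : H → ℂ) + a₃ + a₁ = _; abel) h₂₃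
    change φ a₂ * φ a₃ + φ a₃ * φ a₁ + φ a₁ * φ a₂ = -1 at this
    linear_combination this
  · have := same i₃ i₁ i₂ (by rw [← h]; change (a₃ : H → ℂ) + a₁ + a₂ = _; abel) (by tauto)
    change φ a₃ * φ a₁ + φ a₁ * φ a₂ + φ a₂ * φ a₃ = -1 at this
    linear_combination this

theorem mul_add_eq_of_root_eq_add {φ : Weight ℂ H 𝔤 → ℂ} (hneg : ∀ a, φ (-a) = -φ a)
    (h : ∀ a b c : Weight ℂ H 𝔤, a.IsNonZero → b.IsNonZero → c.IsNonZero →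
      (a : H → ℂ) + b + c = 0 → φ a * φ b + φ b * φ c + φ c * φ a = -1)
    {i j k : H.root} (hk : (rootSystem H).root k = (rootSystem H).root i + (rootSystem H).root j) :
    φ k * (φ i + φ j) = 1 + φ i * φ j := by
  have := h i j (-k) (H.isNonZero_coe_root i) (H.isNonZero_coe_root j)
    (by simpa using H.isNonZero_coe_root k) (by
      rw [Weight.coe_neg]
      ext x
      have := LinearMap.congr_fun hk x
      change (k : Weight ℂ H 𝔤) x = (i : Weight ℂ H 𝔤) x + (j : Weight ℂ H 𝔤) x at this
      change (i : Weight ℂ H 𝔤) x + (j : Weight ℂ H 𝔤) x + -(k : Weight ℂ H 𝔤) x = 0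
      rw [this, add_neg_cancel])
  rw [hneg] at this
  linear_combination -this

/-- Local solution of the equations for the coefficients of a dynamical r-matrix. -/
theorem exists_eq_stdCoeff {φ : Weight ℂ H 𝔤 → Dual ℂ H → ℂ} {x₀ : Dual ℂ H} {ε : ℝ} (hε : 0 < ε)
    (hneg : ∀ a, ∀ x ∈ Metric.ball x₀ ε, φ (-a) x = -φ a x)
    (hderiv : ∀ a : Weight ℂ H 𝔤, a.IsNonZero → ∀ x ∈ Metric.ball x₀ ε,
      HasFDerivAt (φ a) ((1 - φ a x ^ 2) • rootFunctional (Weight.toLinear ℂ H 𝔤 a)) x)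
    (hadd : ∀ a b c : Weight ℂ H 𝔤, a.IsNonZero → b.IsNonZero → c.IsNonZero →
      (a : H → ℂ) + b + c = 0 → ∀ x ∈ Metric.ball x₀ ε,
        φ a x * φ b x + φ b x * φ c x + φ c x * φ a x = -1) :
    ∃ (b : (rootSystem H).Base) (S : Set H.root) (lam₀ : H), S ⊆ b.support ∧
      ∀ i, b.IsPos i → ∀ x ∈ Metric.ball x₀ ε, φ i x = stdCoeff b S lam₀ x i := by
  have hx₀ : x₀ ∈ Metric.ball x₀ ε := Metric.mem_ball_self hε
  have hadd' : ∀ i j k : H.root,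
      (rootSystem H).root k = (rootSystem H).root i + (rootSystem H).root j →
        ∀ x ∈ Metric.ball x₀ ε, φ k x * (φ i x + φ j x) = 1 + φ i x * φ j x :=
    fun i j k hk x hx => mul_add_eq_of_root_eq_add (φ := fun a => φ a x) (fun a => hneg a x hx)
      (fun a b c ha hb hc h => hadd a b c ha hb hc h x hx) hk
  have hrefl : ∀ i : H.root, φ ((rootSystem H).reflectionPerm i i) x₀ = -φ i x₀ := fun i => by
    rw [coe_reflectionPerm_self, hneg _ _ hx₀]
  let Q : Set H.root := {i | φ i x₀ ≠ -1}
  have hQadd : ∀ i j k : H.root,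
      (rootSystem H).root k = (rootSystem H).root i + (rootSystem H).root j →
        i ∈ Q → j ∈ Q → k ∈ Q := by
    intro i j k hk hi hj hk1
    have h := hadd' i j k hk x₀ hx₀
    -- With `φ_k = -1` the addition law factors, so closure of `Q` under addition follows.
    have h0 : (φ i x₀ + 1) * (φ j x₀ + 1) = 0 := by
      rw [hk1] at h
      linear_combination -h
    rcases mul_eq_zero.mp h0 with h0 | h0
    · exact hi (eq_neg_of_add_eq_zero_left h0)
    · exact hj (eq_neg_of_add_eq_zero_left h0)
  obtain ⟨b, hb⟩ := exists_base_forall_isPos_mem (P := rootSystem H) (Q := Q) (fun i => by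
    by_contra! h
    have h1 : φ i x₀ = -1 := not_not.mp h.1
    have h2 : φ ((rootSystem H).reflectionPerm i i) x₀ = -1 := not_not.mp h.2
    rw [hrefl, h1] at h2
    norm_num at h2) hQadd
  -- For `j` in `S` both `j` and `-j` lie in `Q`, that is `φ_j(x₀) ≠ ±1`: these are the simple roots
  -- with a genuine `coth` solution.
  let S : Set H.root := {j | j ∈ b.support ∧ (rootSystem H).reflectionPerm j j ∈ Q}
  have hS : S ⊆ b.support := fun j hj => hj.1
  have hφ : ∀ i : H.root, ∀ x ∈ Metric.ball x₀ ε,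
      HasFDerivAt (φ i) ((1 - φ i x ^ 2) • rootFunctional ((rootSystem H).root i)) x :=
    fun i => hderiv i (H.isNonZero_coe_root i)
  have hc : ∀ j : H.root, ∃ c : ℂ, j ∈ S → ∀ x ∈ Metric.ball x₀ ε,
      φ j x * Complex.sinh (rootFunctional ((rootSystem H).root j) x + c) =
        Complex.cosh (rootFunctional ((rootSystem H).root j) x + c) := by
    intro j
    by_cases hj : j ∈ S
    · obtain ⟨c, hc⟩ := riccati_mul_sinh_eq_cosh (hφ j)
        (fun h => hj.2 (by rw [hrefl, h])) (hb j (b.isPos_of_mem_support hj.1))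
      exact ⟨c, fun _ => hc⟩
    -- Outside `S` the constant is arbitrary; `0` is a default value.
    · exact ⟨0, fun h => absurd h hj⟩
  choose c hc using hc
  obtain ⟨lam₀, hlam₀⟩ := exists_forall_root_apply_eq b c
  refine ⟨b, S, lam₀, hS, fun i hi x hx => ?_⟩
  rw [stdCoeff]
  split_ifs with hiS
  · refine eq_coth_of_mul_eq_cosh (spanned_induction_on_add b hS (p := fun i =>
      φ i x * Complex.sinh (rootFunctional ((rootSystem H).root i) x + (rootSystem H).root i lam₀) =
        Complex.cosh (rootFunctional ((rootSystem H).root i) x + (rootSystem H).root i lam₀))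
      (fun j hj => ?_) (fun i j k hk _ _ hi hj => ?_) hi hiS.2)
    · rw [hlam₀ j hj.1]
      exact hc j hj x hx
    · have hj' := hc j hj x hx
      rw [← hlam₀ j hj.1] at hj'
      have := mul_sinh_add_eq_cosh_add hi hj' (hadd' i j k hk x hx)
      rwa [add_add_add_comm, ← rootFunctional_add, ← LinearMap.add_apply, ← hk] at this
  -- Outside `[S]` the value at `x₀` is `1`: otherwise `-i ∈ Q`, and `i` would be spanned by `S`.
  · refine riccati_eq_one (hφ i) ?_ hx
    by_contra h1
    refine hiS ⟨hi, root_mem_closure_of_neg_mem hQadd hb hi fun h => h1 ?_⟩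
    rw [hrefl] at h
    exact neg_inj.mp h

variable {E : Weight ℂ H 𝔤 → 𝔤} (b : (rootSystem H).Base) (S : Set H.root) (lam₀ : H)

theorem isMeromorphicOn_standardRMatrix (U : Set (Dual ℂ H)) :
    IsMeromorphicOn (standardRMatrix E b S lam₀) U := by
  classical
  have h : standardRMatrix E b S lam₀ = fun x => ∑ a : H.root with a ∈ positiveRoots b,
      stdCoeff b S lam₀ x a • wedge (E a) (E (-a)) :=
    funext fun x => standardRMatrix_eq_sum b S lam₀ x
  rw [h]
  refine IsMeromorphicOn.sum _ fun a _ => ?_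
  by_cases ha : a ∈ spannedRoots b S
  · simp only [stdCoeff, ha, if_true]
    exact isMeromorphicOn_coth_smul (rootFunctional_ne_zero ((rootSystem H).ne_zero a)) _ _ U
  · simp only [stdCoeff, ha, if_false]
    exact isMeromorphicOn_of_analyticOnNhd fun x _ => analyticAt_const

theorem hasFDerivAt_stdCoeff {x : Dual ℂ H} {a : H.root}
    (hx : Complex.sinh (rootFunctional ((rootSystem H).root a) x + (rootSystem H).root a lam₀) ≠ 0) :
    HasFDerivAt (fun y => stdCoeff b S lam₀ y a)
      ((1 - stdCoeff b S lam₀ x a ^ 2) • rootFunctional ((rootSystem H).root a)) x := by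
  by_cases ha : a ∈ spannedRoots b S
  · simp only [stdCoeff, ha, if_true]
    exact hasFDerivAt_coth _ _ hx
  · simp only [stdCoeff, ha, if_false]
    exact (hasFDerivAt_const (1 : ℂ) x).congr_fderiv (by ext; simp)

-- Because `[S]` spans a face, `k ∈ [S]` exactly when `i` and `j` both are. Inside, this is the
-- addition law of `coth`; otherwise `φ_k` and one of `φ_i`, `φ_j` are `1`, and both sides agree.
variable {S} in
theorem stdCoeff_mul_add (hS : S ⊆ b.support) {x : Dual ℂ H}
    (hx : ∀ a, Complex.sinh
      (rootFunctional ((rootSystem H).root a) x + (rootSystem H).root a lam₀) ≠ 0)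
    {i j k : H.root} (hk : (rootSystem H).root k = (rootSystem H).root i + (rootSystem H).root j)
    (hi : b.IsPos i) (hj : b.IsPos j) :
    stdCoeff b S lam₀ x k * (stdCoeff b S lam₀ x i + stdCoeff b S lam₀ x j) =
      1 + stdCoeff b S lam₀ x i * stdCoeff b S lam₀ x j := by
  have hi' := (isPos_iff_mem_closure b).mp hi
  have hj' := (isPos_iff_mem_closure b).mp hj
  have hkpos : b.IsPos k := (isPos_iff_mem_closure b).mpr (hk ▸ add_mem hi' hj')
  by_cases hkS : k ∈ spannedRoots b S
  · have hij := mem_closure_of_add_mem_closure b hS hi' hj' (hk ▸ hkS.2)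
    have hiS : i ∈ spannedRoots b S := ⟨hi, hij.1⟩
    have hjS : j ∈ spannedRoots b S := ⟨hj, hij.2⟩
    simp only [stdCoeff, hkS, hiS, hjS, if_true]
    have hxk := hx k
    have h : rootFunctional ((rootSystem H).root k) x + (rootSystem H).root k lam₀ =
        (rootFunctional ((rootSystem H).root i) x + (rootSystem H).root i lam₀) +
          (rootFunctional ((rootSystem H).root j) x + (rootSystem H).root j lam₀) := by
      rw [hk, rootFunctional_add, LinearMap.add_apply, add_add_add_comm]
    rw [h] at hxk ⊢
    exact coth_add_mul (hx i) (hx j) hxk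
  · have h1 : stdCoeff b S lam₀ x k = 1 := by simp only [stdCoeff, hkS, if_false]
    have hij : i ∉ spannedRoots b S ∨ j ∉ spannedRoots b S := by
      by_contra! h
      exact hkS ⟨hkpos, hk ▸ add_mem h.1.2 h.2.2⟩
    rcases hij with h | h
    · have h2 : stdCoeff b S lam₀ x i = 1 := by simp only [stdCoeff, h, if_false]
      rw [h1, h2]; ring
    · have h2 : stdCoeff b S lam₀ x j = 1 := by simp only [stdCoeff, h, if_false]
      rw [h1, h2]; ring

end Coefficients

theorem differentiableAt_clm_comp {E F G : Type*} [NormedAddCommGroup E]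
    [NormedSpace ℂ E] [NormedAddCommGroup F] [NormedSpace ℂ F] [NormedAddCommGroup G]
    [NormedSpace ℂ G] {f : E → F} {x : E} (hf : DifferentiableAt ℂ f x) (L : F →L[ℂ] G) :
    DifferentiableAt ℂ (fun y => L (f y)) x :=
  L.differentiableAt.comp x hf

/-! ### The two implications. -/

section Classification

open LieAlgebra LieModule LieAlgebra.IsKilling

variable {𝔤 : Type*} [LieRing 𝔤] [LieAlgebra ℂ 𝔤] [FiniteDimensional ℂ 𝔤]
  [LieAlgebra.IsKilling ℂ 𝔤] {H : LieSubalgebra ℂ 𝔤} [H.IsCartanSubalgebra]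
  {E : Weight ℂ H 𝔤 → 𝔤}
  (hE : ∀ a : Weight ℂ H 𝔤, a.IsNonZero → E a ∈ rootSpace H a)
  (hE_norm : ∀ a : Weight ℂ H 𝔤, a.IsNonZero → killingForm ℂ 𝔤 (E a) (E (-a)) = 1)
  {U : Set (Dual ℂ H)} {r : Dual ℂ H → 𝔤 ⊗[ℂ] 𝔤}

include hE hE_norm in
theorem IsDynamicalRMatrix.exists_eq_standardRMatrix (h : IsDynamicalRMatrix 2 U r)
    (hU : IsOpen U) (hUc : IsConnected U) :
    ∃ (b : (rootSystem H).Base) (S : Set H.root) (lam₀ : H)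
      (w : Dual ℂ H → Dual ℂ H [⋀^Fin 2]→L[ℂ] ℂ), S ⊆ b.support ∧
        IsClosedMeromorphicTwoForm w U ∧
          GenericallyOn U fun lam =>
            r lam = formToTensor (w lam) + standardRMatrix E b S lam₀ lam := by
  have : CompleteSpace (𝔤 ⊗[ℂ] 𝔤) := FiniteDimensional.complete ℂ _
  let L : 𝔤 ⊗[ℂ] 𝔤 →L[ℂ] Dual ℂ H [⋀^Fin 2]→L[ℂ] ℂ := LinearMap.toContinuousLinearMap tensorToForm
  let w : Dual ℂ H → Dual ℂ H [⋀^Fin 2]→L[ℂ] ℂ := fun y => L (r y)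
  have hw : ∀ {x}, AnalyticAt ℂ r x → DifferentiableAt ℂ w x := fun ha => by
    have := differentiableAt_clm_comp (G := Dual ℂ H [⋀^Fin 2]→L[ℂ] ℂ) ha.differentiableAt L
    exact this
  have hwm : IsMeromorphicOn w U := by
    have := IsMeromorphicOn.clm_comp (G := Dual ℂ H [⋀^Fin 2]→L[ℂ] ℂ) h.meromorphic L
    exact this
  have hgen : GenericallyOn U fun x => AnalyticAt ℂ r x ∧ (∀ᶠ y in 𝓝 x, r y ∈ zeroWeightSkew H) ∧
      altD r x + (1 / 2 : ℂ) • schouten 𝔤 (r x) (r x) =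
        ((2 : ℂ) ^ 2 / 4) • comm₁₂₂₃ 𝔤 (casimir 𝔤) (casimir 𝔤) :=
    h.meromorphic.genericallyOn_analyticAt.and
      ((((genericallyOn_of_forall hU h.mem_wedgeTwo).and h.zeroWeight).eventually).and h.cdybe)
  have hcomp : ∀ x, AnalyticAt ℂ r x → (∀ᶠ y in 𝓝 x, r y ∈ zeroWeightSkew H) →
      altD r x + (1 / 2 : ℂ) • schouten 𝔤 (r x) (r x) =
        ((2 : ℂ) ^ 2 / 4) • comm₁₂₂₃ 𝔤 (casimir 𝔤) (casimir 𝔤) →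
      (∀ a : Weight ℂ H 𝔤, a.IsNonZero → HasFDerivAt (fun y => rootCoeff E a (r y))
        ((1 - rootCoeff E a (r x) ^ 2) • rootFunctional (Weight.toLinear ℂ H 𝔤 a)) x) ∧
      (∀ a b c : Weight ℂ H 𝔤, a.IsNonZero → b.IsNonZero → c.IsNonZero →
        (a : H → ℂ) + b + c = 0 → rootCoeff E a (r x) * rootCoeff E b (r x) +
          rootCoeff E b (r x) * rootCoeff E c (r x) +
            rootCoeff E c (r x) * rootCoeff E a (r x) = -1) ∧
      extDeriv w x = 0 := fun x ha hZ hx =>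
    (cdybe_at_iff (w := w) hE hE_norm ha.differentiableAt
      (hw ha) hZ
      (hZ.mono fun y hy k k' => (tensorToForm_apply hy.1 k k').symm)).mp hx
  -- All conditions hold on a ball around one generic point; the discrete data and `λ₀` are read off
  -- there.
  obtain ⟨x₀, hx₀, hx₀'⟩ := hgen.eventually.exists_mem hU hUc.nonempty
  obtain ⟨ε, hε, hball⟩ := Metric.eventually_nhds_iff_ball.mp (hx₀'.and (hU.mem_nhds hx₀))
  have hloc := fun x hx => hcomp x (hball x hx).1.1 (hball x hx).1.2.1 (hball x hx).1.2.2
  have hZ : ∀ x ∈ Metric.ball x₀ ε, r x ∈ zeroWeightSkew H := fun x hx =>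
    (hball x hx).1.2.1.self_of_nhds
  obtain ⟨b, S, lam₀, hS, hb⟩ := exists_eq_stdCoeff (φ := fun a x => rootCoeff E a (r x)) hε
    (fun a x hx => rootCoeff_neg (hZ x hx).1 a) (fun a ha x hx => (hloc x hx).1 a ha)
    (fun a b c ha hb hc h x hx => (hloc x hx).2.1 a b c ha hb hc h)
  refine ⟨b, S, lam₀, w, hS, ⟨hwm, hgen.mono (fun x _ hx =>
    (hcomp x hx.1 hx.2.1 hx.2.2).2.2) hU⟩, ?_⟩
  -- `M` extracts the Cartan part. Its linearity makes `M ∘ r` meromorphic, so the identity theorem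
  -- applies to the difference of the two sides.
  let M : 𝔤 ⊗[ℂ] 𝔤 →ₗ[ℂ] 𝔤 ⊗[ℂ] 𝔤 :=
    { toFun := fun t => formToTensor (tensorToForm (H := H) t)
      map_add' := fun s t => by
        simp only [formToTensor, map_add, ContinuousAlternatingMap.add_apply, add_smul,
          Finset.sum_add_distrib]
      map_smul' := fun c t => by
        simp only [formToTensor, map_smul, ContinuousAlternatingMap.smul_apply, smul_assoc,
          Finset.smul_sum, RingHom.id_apply] }
  have hmer := h.meromorphic.sub ((h.meromorphic.clm_comp (LinearMap.toContinuousLinearMap M)).add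
    (isMeromorphicOn_standardRMatrix (E := E) b S lam₀ U))
  refine (hmer.genericallyOn_eq_zero hUc.isPreconnected Metric.isOpen_ball
    (fun x hx => (hball x hx).2) ⟨x₀, Metric.mem_ball_self hε⟩ fun x hx => ?_).mono
    (fun x _ hx => sub_eq_zero.mp hx) hU
  refine sub_eq_zero.mpr (eq_of_rootCoeff_eq hE hE_norm b (hZ x hx)
    (add_mem (formToTensor_mem_zeroWeightSkew (tensorToForm (r x)))
      (standardRMatrix_mem_zeroWeightSkew hE b S lam₀ x)) (fun a ha => ?_) fun k k' => ?_)
  · rw [map_add, rootCoeff_standardRMatrix hE hE_norm b S lam₀ x ha, ← hb a ha x hx]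
    exact right_eq_add.mpr (rootCoeff_formToTensor hE (tensorToForm (r x)) (H.isNonZero_coe_root a))
  · rw [map_add, killingPair_coe_coe_standardRMatrix hE, add_zero]
    exact (tensorToForm_apply (hZ x hx).1 k k').symm.trans
      (killingPair_formToTensor (tensorToForm (r x)) k k').symm

include hE hE_norm in
theorem isDynamicalRMatrix_of_eq_standardRMatrix (hU : IsOpen U)
    (hr_wedge : ∀ lam ∈ U, r lam ∈ wedgeTwo 𝔤) (hr : IsMeromorphicOn r U)
    {b : (rootSystem H).Base} {S : Set H.root} {lam₀ : H}
    {w : Dual ℂ H → Dual ℂ H [⋀^Fin 2]→L[ℂ] ℂ} (hS : S ⊆ b.support)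
    (hw : IsClosedMeromorphicTwoForm w U)
    (hrw : GenericallyOn U fun lam =>
      r lam = formToTensor (w lam) + standardRMatrix E b S lam₀ lam) :
    IsDynamicalRMatrix 2 U r := by
  classical
  have : CompleteSpace (𝔤 ⊗[ℂ] 𝔤) := FiniteDimensional.complete ℂ _
  -- A generic point avoids the poles of every `coth⟨α, λ + λ₀⟩` simultaneously, there being
  -- finitely many roots.
  have hsinh : GenericallyOn U fun x => ∀ a ∈ (Finset.univ : Finset H.root), Complex.sinh
      (rootFunctional ((rootSystem H).root a) x + (rootSystem H).root a lam₀) ≠ 0 :=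
    GenericallyOn.forall_finset hU _ fun a _ =>
      genericallyOn_sinh_affine_ne_zero (rootFunctional_ne_zero ((rootSystem H).ne_zero a)) _ U
  have hZ : ∀ {y}, r y = formToTensor (w y) + standardRMatrix E b S lam₀ y →
      r y ∈ zeroWeightSkew H := fun {y} hy => hy ▸ add_mem (formToTensor_mem_zeroWeightSkew _)
    (standardRMatrix_mem_zeroWeightSkew hE b S lam₀ y)
  have hpos : ∀ {y} {a : H.root}, r y = formToTensor (w y) + standardRMatrix E b S lam₀ y →
      b.IsPos a → rootCoeff E a (r y) = stdCoeff b S lam₀ y a := fun {y a} hy ha => by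
    rw [hy, map_add, rootCoeff_formToTensor hE _ (H.isNonZero_coe_root a), zero_add,
      rootCoeff_standardRMatrix hE hE_norm b S lam₀ y ha]
  refine ⟨hr_wedge, hr, hrw.mono (fun x _ hx => (hZ hx).2) hU, ?_⟩
  refine (((hrw.eventually.and hr.genericallyOn_analyticAt).and
    (hw.meromorphic.genericallyOn_analyticAt.and hw.closed)).and hsinh).mono ?_ hU
  rintro x - ⟨⟨⟨hx, hra⟩, hwa, hwx⟩, hxs⟩
  have hZx := hx.mono fun y hy => hZ hy
  refine (cdybe_at_iff hE hE_norm hra.differentiableAt hwa.differentiableAt hZx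
    (hx.mono fun y hy k k' => ?_)).mpr ⟨?_, ?_, hwx⟩
  · rw [hy, map_add, killingPair_coe_coe_standardRMatrix hE, add_zero, killingPair_formToTensor]
  · have hA : ∀ a : H.root, b.IsPos a → HasFDerivAt (fun y => rootCoeff E a (r y))
        ((1 - rootCoeff E a (r x) ^ 2) • rootFunctional ((rootSystem H).root a)) x :=
      fun a ha => by
        rw [hpos hx.self_of_nhds ha]
        exact (hasFDerivAt_stdCoeff b S lam₀ (hxs a (Finset.mem_univ a))).congr_of_eventuallyEq
          (hx.mono fun y hy => hpos hy ha)
    intro a ha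
    let i : H.root := ⟨a, by simpa using ha⟩
    by_cases hi : b.IsPos i
    · exact hA i hi
    -- For a negative root the Riccati equation follows from that of its opposite, since coefficient
    -- and functional both change sign.
    · have h := hA _ ((RootPairing.Base.IsPos.or_neg b i).resolve_left hi)
      change HasFDerivAt
        (fun y => rootCoeff E ((rootSystem H).reflectionPerm i i : H.root) (r y))
        ((1 - rootCoeff E ((rootSystem H).reflectionPerm i i : H.root) (r x) ^ 2) •
          rootFunctional ((rootSystem H).root ((rootSystem H).reflectionPerm i i))) x at h
      rw [coe_reflectionPerm_self, RootPairing.root_reflectionPerm,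
        RootPairing.reflection_apply_self, rootFunctional_neg,
        rootCoeff_neg hZx.self_of_nhds.1] at h
      have h' := h.neg.congr_of_eventuallyEq (f₁ := fun y => rootCoeff E i (r y))
        (hZx.mono fun y hy => by
          change rootCoeff E i (r y) = -rootCoeff E (-(i : Weight ℂ H 𝔤)) (r y)
          rw [rootCoeff_neg hy.1, neg_neg])
      exact h'.congr_fderiv (by rw [neg_sq, smul_neg, neg_neg]; rfl)
  · intro a₁ a₂ a₃ h₁ h₂ h₃ h
    refine add_mul_eq_neg_one_of_isPos (φ := fun a => rootCoeff E a (r x))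
      (rootCoeff_neg hZx.self_of_nhds.1) b (fun i j k hk hi hj => ?_) h₁ h₂ h₃ h
    have hk' : b.IsPos k := (isPos_iff_mem_closure b).mpr
      (hk ▸ add_mem ((isPos_iff_mem_closure b).mp hi) ((isPos_iff_mem_closure b).mp hj))
    simp only [hpos hx.self_of_nhds hi, hpos hx.self_of_nhds hj, hpos hx.self_of_nhds hk']
    exact stdCoeff_mul_add b lam₀ hS (fun a => hxs a (Finset.mem_univ a)) hk hi hj

end Classification

end DynamicalRMatrix

end

open DynamicalRMatrix in
theorem corollary4p6 {𝔤 : Type*} [LieRing 𝔤] [LieAlgebra ℂ 𝔤] [FiniteDimensional ℂ 𝔤]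
    [LieAlgebra.IsSimple ℂ 𝔤] (H : LieSubalgebra ℂ 𝔤) [H.IsCartanSubalgebra]
    (E : LieModule.Weight ℂ H 𝔤 → 𝔤)
    (hE : ∀ a : LieModule.Weight ℂ H 𝔤, a.IsNonZero → E a ∈ LieAlgebra.rootSpace H a)
    (hE_norm : ∀ a : LieModule.Weight ℂ H 𝔤, a.IsNonZero →
      killingForm ℂ 𝔤 (E a) (E (-a)) = 1)
    (U : Set (Module.Dual ℂ H)) (hU : IsOpen U) (hU_conn : IsConnected U)
    (r : Module.Dual ℂ H → 𝔤 ⊗[ℂ] 𝔤) (hr_wedge : ∀ lam ∈ U, r lam ∈ wedgeTwo 𝔤)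
    (hr : IsMeromorphicOn r U) :
    IsDynamicalRMatrix 2 U r ↔
      ∃ (b : (LieAlgebra.IsKilling.rootSystem H).Base) (S : Set H.root) (lam₀ : H)
        (w : Module.Dual ℂ H → Module.Dual ℂ H [⋀^Fin 2]→L[ℂ] ℂ),
        S ⊆ b.support ∧ IsClosedMeromorphicTwoForm w U ∧
          GenericallyOn U fun lam =>
            r lam = formToTensor (w lam) + standardRMatrix E b S lam₀ lam :=
  ⟨fun h => h.exists_eq_standardRMatrix hE hE_norm hU hU_conn, fun ⟨_, _, _, _, hS, hw, hrw⟩ =>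
    isDynamicalRMatrix_of_eq_standardRMatrix hE hE_norm hU hr_wedge hr hS hw hrw⟩
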